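/- \textbf{Proposition (confluence of the computational $\lambda\Box$-calculus).} Types are $\sigma ::= p \mid \sigma\supset\sigma \mid \Box\sigma$, with $p$ ranging over type constants. Terms $M$ and values $V$ (up to $\alpha$-equivalence) are $$M ::= c \mid x \mid \lambda x^{\sigma}.M \mid MM \mid \mathtt{box}\ x_1^{\sigma_1},\dots,x_n^{\sigma_n}=M_1,\dots,M_n\ \mathtt{in}\ V \mid \mathtt{let}\ x=M\ \mathtt{in}\ M,$$ $$V ::= c \mid x \mid \lambda x^{\sigma}.M \mid \mathtt{box}\ x_1^{\sigma_1},\dots,x_n^{\sigma_n}=V_1,\dots,V_n\ \mathtt{in}\ V\qquad(n\ge 0),$$ where $c$ ranges over constants, each with a given type, and the free variables of $\mathtt{box}\ \vec x=\vec N\ \mathtt{in}\ M$ are those of $\vec N$. Simple evaluation contexts are $$C ::= {-}\,M \mid V\,{-} \mid \mathtt{box}\ x_1^{\sigma_1},\dots,x_n^{\sigma_n}=V_1,\dots,V_{i-1},-,M_{i+1},\dots,M_n\ \mathtt{in}\ V.$$ Constants, variables, abstractions, applications and $\mathtt{let}$ are typed as usual in the simply typed $\lambda$-calculus; if $x_1:\sigma_1,\dots,x_n:\sigma_n\vdash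 M:\tau$ and $\Gamma\vdash N_i:\Box\sigma_i$ for $i=1,\dots,n$, then $\Gamma\vdash \mathtt{box}\ x_1^{\sigma_1},\dots,x_n^{\sigma_n}=N_1,\dots,N_n\ \mathtt{in}\ M:\Box\tau$. Let $\to_{\mathsf c}$ be the closure under all term formers of the following rules, where $V$ and the entries of $\vec W$ are values and $A$ is a term that is not a value: \begin{align*} \mathtt{let}\ x=M\ \mathtt{in}\ x &\to M\\ \mathtt{let}\ x=V\ \mathtt{in}\ M &\to M[x:=V]\\ (\lambda x.M)V &\to M[x:=V]\\ \lambda x.Vx &\to V && (x\notin FV(V))\\ \mathtt{let}\ x=(\mathtt{let}\ y=L\ \mathtt{in}\ N)\ \mathtt{in}\ M &\to \mathtt{let}\ y=L\ \mathtt{in}\ \mathtt{let}\ x=N\ \mathtt{in}\ M && (y\notin FV(M))\\ C[A] &\to \mathtt{let}\ x=A\ \mathtt{in}\ C[x] && (x \text{ fresh})\\ \mathtt{box}\ x=M\ \mathtt{in}\ x &\to M\\ \mathtt{box}\ \vec w,x,\vec z=\vec W,(\mathtt{box}\ \vec y=\vec N\ \mathtt{in}\ V),\vec P\ \mathtt{in}\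 M &\to \mathtt{box}\ \vec w,\vec y,\vec z=\vec W,\vec N,\vec P\ \mathtt{in}\ M[x:=V] && (|\vec w|=|\vec W|) \end{align*} Then $\to_{\mathsf c}$ is confluent on typable terms: if $\Gamma\vdash M:\tau$, $M\to_{\mathsf c}^{*}N_1$ and $M\to_{\mathsf c}^{*}N_2$, then there is a term $L$ with $N_1\to_{\mathsf c}^{*}L$ and $N_2\to_{\mathsf c}^{*}L$. -/

import Mathlib

namespace LambdaBox

/-- Types `σ ::= p | σ ⊃ σ | □σ` over a set `P` of type constants. -/
inductive Ty (P : Type*) where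
  | base (p : P) : Ty P
  | imp (σ τ : Ty P) : Ty P
  | nec (σ : Ty P) : Ty P

/-- Raw terms over type constants `P` and constants `K`, up to renaming of bound variables
(de Bruijn indices):
`M ::= c | x | λ x^σ. M | M M | box x₁^σ₁, …, xₙ^σₙ = M₁, …, Mₙ in M | let x = N in M`.

* `lam σ M` and `letin N M` bind index `0` in `M`.
* `box σs Ns M` binds index `j` of `M` to the `j`-th entry of `Ns`. The body `M` has no other
  variables in scope: the free variables of a box term are those of `Ns`. -/
inductive Term (P K : Type*) where
  | const (c : K) : Term P K
  | var (x : ℕ) : Term P K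
  | lam (σ : Ty P) (M : Term P K) : Term P K
  | app (M N : Term P K) : Term P K
  | box (σs : List (Ty P)) (Ns : List (Term P K)) (M : Term P K) : Term P K
  | letin (N M : Term P K) : Term P K

variable {P K : Type*}

namespace Term

/-- Extension of a renaming under one binder. -/
def liftRen (f : ℕ → ℕ) : ℕ → ℕ
  | 0 => 0
  | x + 1 => f x + 1

mutual
/-- Renaming of the free variables. -/
def rename : (ℕ → ℕ) → Term P K → Term P K
  | _, const c => const c
  | f, var x => var (f x)
  | f, lam σ M => lam σ (rename (liftRen f) M)
  | f, app M N => app (rename f M) (rename f N)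
  | f, box σs Ns M => box σs (renameList f Ns) M
  | f, letin N M => letin (rename f N) (rename (liftRen f) M)
/-- Renaming in each term of a list. -/
def renameList : (ℕ → ℕ) → List (Term P K) → List (Term P K)
  | _, [] => []
  | f, N :: Ns => rename f N :: renameList f Ns
end

theorem renameList_eq_map (f : ℕ → ℕ) (Ns : List (Term P K)) :
    renameList f Ns = Ns.map (rename f) := by
  induction Ns with
  | nil => simp [renameList]
  | cons N Ns ih => simp [renameList, ih]

/-- Weakening by one fresh variable, which becomes index `0`. -/
def shift (M : Term P K) : Term P K := rename Nat.succ M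

/-- Extension of a substitution under one binder. -/
def liftSub (s : ℕ → Term P K) : ℕ → Term P K
  | 0 => var 0
  | x + 1 => shift (s x)

mutual
/-- Simultaneous capture-avoiding substitution for the free variables. -/
def subst : (ℕ → Term P K) → Term P K → Term P K
  | _, const c => const c
  | s, var x => s x
  | s, lam σ M => lam σ (subst (liftSub s) M)
  | s, app M N => app (subst s M) (subst s N)
  | s, box σs Ns M => box σs (substList s Ns) M
  | s, letin N M => letin (subst s N) (subst (liftSub s) M)
/-- Substitution in each term of a list. -/
def substList : (ℕ → Term P K) → List (Term P K) → List (Term P K)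
  | _, [] => []
  | s, N :: Ns => subst s N :: substList s Ns
end

theorem substList_eq_map (s : ℕ → Term P K) (Ns : List (Term P K)) :
    substList s Ns = Ns.map (subst s) := by
  induction Ns with
  | nil => simp [substList]
  | cons N Ns ih => simp [substList, ih]

/-- The substitution of `N` for index `0`, lowering all other indices. -/
def single (N : Term P K) : ℕ → Term P K
  | 0 => N
  | x + 1 => var x

/-- `M[x := N]`, where `x` is index `0` of `M`. -/
def inst (M N : Term P K) : Term P K := subst (single N) M

/-- The substitution `[x := V]` from the scope `w₁, …, w_a, x, z₁, …` to the scope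
`w₁, …, w_a, y₁, …, y_b, z₁, …`, where `V` lives in the scope `y₁, …, y_b`. -/
def mergeSub (a b : ℕ) (V : Term P K) (j : ℕ) : Term P K :=
  if j < a then var j
  else if j = a then rename (fun y => a + y) V
  else var (j - 1 + b)

end Term

open Term

/-- Values `V ::= c | x | λ x^σ. M | box x₁^σ₁, …, xₙ^σₙ = V₁, …, Vₙ in M`. -/
inductive Value : Term P K → Prop
  | const (c : K) : Value (const c)
  | var (x : ℕ) : Value (var x)
  | lam (σ : Ty P) (M : Term P K) : Value (lam σ M)
  | box (σs : List (Ty P)) (Vs : List (Term P K)) (M : Term P K) :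
      (∀ V ∈ Vs, Value V) → Value (box σs Vs M)

/-- The terms of the calculus among the raw terms: the body of every box is a value, i.e.
`M ::= c | x | λ x^σ. M | M M | box x₁^σ₁, …, xₙ^σₙ = M₁, …, Mₙ in V | let x = M in M`. -/
inductive Restricted : Term P K → Prop
  | const (c : K) : Restricted (const c)
  | var (x : ℕ) : Restricted (var x)
  | lam (σ : Ty P) (M : Term P K) : Restricted M → Restricted (lam σ M)
  | app (M N : Term P K) : Restricted M → Restricted N → Restricted (app M N)
  | box (σs : List (Ty P)) (Ns : List (Term P K)) (V : Term P K) :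
      (∀ N ∈ Ns, Restricted N) → Value V → Restricted V → Restricted (box σs Ns V)
  | letin (N M : Term P K) : Restricted N → Restricted M → Restricted (letin N M)

/-- `HasType tc Γ M τ` is `Γ ⊢ M : τ`, where `tc c` is the type of the constant `c` and index `x`
has the `x`-th type of `Γ`. The body of a box is typed in the context of its own variables. -/
inductive HasType (tc : K → Ty P) : List (Ty P) → Term P K → Ty P → Prop
  | const (Γ : List (Ty P)) (c : K) : HasType tc Γ (const c) (tc c)
  | var (Γ : List (Ty P)) (x : ℕ) (τ : Ty P) : Γ[x]? = some τ → HasType tc Γ (var x) τ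
  | lam (Γ : List (Ty P)) (σ τ : Ty P) (M : Term P K) :
      HasType tc (σ :: Γ) M τ → HasType tc Γ (lam σ M) (.imp σ τ)
  | app (Γ : List (Ty P)) (σ τ : Ty P) (M N : Term P K) :
      HasType tc Γ M (.imp σ τ) → HasType tc Γ N σ → HasType tc Γ (app M N) τ
  | box (Γ σs : List (Ty P)) (τ : Ty P) (Ns : List (Term P K)) (M : Term P K) :
      HasType tc σs M τ → Ns.length = σs.length →
      (∀ p ∈ Ns.zip σs, HasType tc Γ p.1 (.nec p.2)) →
      HasType tc Γ (box σs Ns M) (.nec τ)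
  | letin (Γ : List (Ty P)) (σ τ : Ty P) (N M : Term P K) :
      HasType tc Γ N σ → HasType tc (σ :: Γ) M τ → HasType tc Γ (letin N M) τ

/-- Contexts of the three shapes `– M`, `M –` and `box x₁, …, xₙ = M₁, …, –, …, Mₙ in M`. -/
inductive Ctx (P K : Type*) where
  | appL (M : Term P K) : Ctx P K
  | appR (V : Term P K) : Ctx P K
  | box (σs : List (Ty P)) (Vs Ms : List (Term P K)) (M : Term P K) : Ctx P K

namespace Ctx

/-- Simple evaluation contexts `C ::= – M | V – | box x₁, …, xₙ = V, …, V, –, M, …, M in M`. -/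
def IsSimple : Ctx P K → Prop
  | appL _ => True
  | appR V => Value V
  | box _ Vs _ _ => ∀ V ∈ Vs, Value V

/-- `C[N]`. -/
def fill : Ctx P K → Term P K → Term P K
  | appL M, N => .app N M
  | appR V, N => .app V N
  | box σs Vs Ms M, N => .box σs (Vs ++ N :: Ms) M

/-- Weakening by one fresh variable, which becomes index `0`. -/
def shift : Ctx P K → Ctx P K
  | appL M => appL M.shift
  | appR V => appR V.shift
  | box σs Vs Ms M => box σs (Vs.map Term.shift) (Ms.map Term.shift) M

end Ctx

/-- The reduction rules. Side conditions of the form `x ∉ FV(M)` are expressed by weakening. -/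
inductive Rule : Term P K → Term P K → Prop
  /-- `let x = M in x → M` -/
  | id_let (M : Term P K) : Rule (letin M (var 0)) M
  /-- `let x = V in M → M[x := V]` -/
  | beta_let (V M : Term P K) : Value V → Rule (letin V M) (M.inst V)
  /-- `(λ x. M) V → M[x := V]` -/
  | beta_imp (σ : Ty P) (M V : Term P K) : Value V → Rule (app (lam σ M) V) (M.inst V)
  /-- `λ x. V x → V` if `x ∉ FV(V)` -/
  | eta_imp (σ : Ty P) (V : Term P K) : Value V → Rule (lam σ (app V.shift (var 0))) V
  /-- `let x = (let y = L in N) in M → let y = L in let x = N in M` if `y ∉ FV(M)` -/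
  | comp (L N M : Term P K) :
      Rule (letin (letin L N) M) (letin L (letin N (M.rename (liftRen Nat.succ))))
  /-- `C[A] → let x = A in C[x]` for `C` a simple evaluation context and `A` not a value -/
  | let_ (C : Ctx P K) (A : Term P K) : C.IsSimple → ¬ Value A →
      Rule (C.fill A) (letin A (C.shift.fill (var 0)))
  /-- `box x = M in x → M` -/
  | id_box (σ : Ty P) (M : Term P K) : Rule (box [σ] [M] (var 0)) M
  /-- `box w⃗, x, z⃗ = W⃗, (box y⃗ = N⃗ in V), P⃗ in M → box w⃗, y⃗, z⃗ = W⃗, N⃗, P⃗ in M[x := V]`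
  if `|w⃗| = |W⃗|` -/
  | beta_box (ρs τs υs : List (Ty P)) (σ : Ty P) (Ws Ns Ps : List (Term P K)) (V M : Term P K) :
      ρs.length = Ws.length → (∀ W ∈ Ws, Value W) → Value V →
      Rule (box (ρs ++ σ :: υs) (Ws ++ box τs Ns V :: Ps) M)
        (box (ρs ++ τs ++ υs) (Ws ++ Ns ++ Ps) (M.subst (mergeSub Ws.length Ns.length V)))

/-- One-step reduction of the computational calculus: the closure of the rules under all term
formers. -/
inductive Step : Term P K → Term P K → Prop
  | rule {M N : Term P K} : Rule M N → Step M N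
  | lam (σ : Ty P) {M M' : Term P K} : Step M M' → Step (lam σ M) (lam σ M')
  | appL {M M' : Term P K} (N : Term P K) : Step M M' → Step (app M N) (app M' N)
  | appR (M : Term P K) {N N' : Term P K} : Step N N' → Step (app M N) (app M N')
  | boxArg (σs : List (Ty P)) (Ps Qs : List (Term P K)) {N N' : Term P K} (M : Term P K) :
      Step N N' → Step (box σs (Ps ++ N :: Qs) M) (box σs (Ps ++ N' :: Qs) M)
  | boxBody (σs : List (Ty P)) (Ns : List (Term P K)) {M M' : Term P K} :
      Step M M' → Step (box σs Ns M) (box σs Ns M')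
  | letL {N N' : Term P K} (M : Term P K) : Step N N' → Step (letin N M) (letin N' M)
  | letR (N : Term P K) {M M' : Term P K} : Step M M' → Step (letin N M) (letin N M')

end LambdaBox

-- Named normal forms: renaming and substitution

namespace LambdaBox

open Term (liftRen)

-- The rules fall into two groups. `id_let`, `beta_let`, `comp` and `let_` are administrative: they
-- name intermediate results and rearrange `let`s. The others are β and η for functions and the two
-- box rules. The translation `nf` into `Anf` evaluates the administrative part once and for all: a
-- term becomes a sequence of calls of values followed by a pure result, and `bind` flattens nested
-- sequences. Both sides of an administrative rule then have the same image, so the critical pairs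
-- involving these rules vanish.
--
-- For the remaining rules the Tait–Martin-Löf method applies. `Par` contracts many redexes at once,
-- including those that appear only after reducing the components: β asks the function part to
-- reduce to an abstraction, `flat` asks a box argument to reduce to a box. Its diamond property on
-- typed terms, `joinable_of_hasT`, goes by induction on size: join the reducts of the components,
-- then see how each contraction survives. β against η is settled by `bind_subst_eta`, two different
-- choices of flattened arguments in a box by `join_args`. Typing matters because of the
-- annotations: `λx^σ. (λy^ρ. Q) x` reduces by η to an abstraction over `ρ` and by β to one over
-- `σ`; similarly for a trivial box inside a box. Typing forces the annotations to coincide, and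
-- `HasT.reduct` keeps the terms typed.
--
-- Finally the two calculi are compared. A step on terms becomes a parallel step (`Step.par_nf`);
-- each term reduces to the reading `emb` of its normal form (`Proper.steps_nf`); a parallel step
-- between typed `Anf` terms is realised by reduction of their readings (`Anf.Par.steps`). Reducts
-- of `M` thus have normal forms that join at some `t`, and `emb t` is a common reduct.

/-- Terms in which every intermediate result is named: `call V W N` is `let x = V W in N`, and
`nil` and `cons` form the argument lists of `box`. -/
inductive Anf (P K : Type*) where
  | const (c : K) : Anf P K
  | var (x : ℕ) : Anf P K
  | lam (σ : Ty P) (N : Anf P K) : Anf P K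
  | call (V W N : Anf P K) : Anf P K
  | box (as M : Anf P K) : Anf P K
  | nil : Anf P K
  | cons (σ : Ty P) (V as : Anf P K) : Anf P K

namespace Anf

variable {P K : Type*}

/-- Renaming of the free variables. -/
def ren : (ℕ → ℕ) → Anf P K → Anf P K
  | _, const c => const c
  | f, var x => var (f x)
  | f, lam σ N => lam σ (ren (liftRen f) N)
  | f, call V W N => call (ren f V) (ren f W) (ren (liftRen f) N)
  | f, box as M => box (ren f as) M
  | _, nil => nil
  | f, cons σ V as => cons σ (ren f V) (ren f as)

/-- Extension of a substitution by a term for index `0`. -/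
def scons (v : Anf P K) (s : ℕ → Anf P K) : ℕ → Anf P K
  | 0 => v
  | x + 1 => s x

/-- Extension of a substitution under one binder. -/
def up (s : ℕ → Anf P K) : ℕ → Anf P K := scons (var 0) fun x => ren Nat.succ (s x)

/-- Simultaneous substitution. -/
def subst : (ℕ → Anf P K) → Anf P K → Anf P K
  | _, const c => const c
  | s, var x => s x
  | s, lam σ N => lam σ (subst (up s) N)
  | s, call V W N => call (subst s V) (subst s W) (subst (up s) N)
  | s, box as M => box (subst s as) M
  | _, nil => nil
  | s, cons σ V as => cons σ (subst s V) (subst s as)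

@[simp] theorem scons_zero (v : Anf P K) (s) : scons v s 0 = v := rfl
@[simp] theorem scons_succ (v : Anf P K) (s) (x : ℕ) : scons v s (x + 1) = s x := rfl
@[simp] theorem up_zero (s : ℕ → Anf P K) : up s 0 = var 0 := rfl
@[simp] theorem up_succ (s : ℕ → Anf P K) (x : ℕ) : up s (x + 1) = ren Nat.succ (s x) := rfl

theorem up_var : up (var : ℕ → Anf P K) = var := by
  funext x; cases x <;> rfl

theorem up_comp_var (f : ℕ → ℕ) :
    up (fun x => (var (f x) : Anf P K)) = fun x => var (liftRen f x) := by
  funext x; cases x <;> rfl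

theorem ren_eq_subst (f : ℕ → ℕ) (t : Anf P K) : ren f t = subst (fun x => var (f x)) t := by
  induction t generalizing f <;> simp_all [ren, subst, up_comp_var]

@[simp] theorem subst_var (t : Anf P K) : subst var t = t := by
  induction t <;> simp_all [subst, up_var]

@[simp] theorem ren_id (t : Anf P K) : ren id t = t := by
  rw [ren_eq_subst]; exact subst_var t

theorem subst_ren (f : ℕ → ℕ) (s : ℕ → Anf P K) (t : Anf P K) :
    subst s (ren f t) = subst (fun x => s (f x)) t := by
  induction t generalizing f s with
  | lam σ N ih =>
    simp only [ren, subst, ih]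
    congr 2; funext x; cases x <;> rfl
  | call V W N ihV ihW ih =>
    simp only [ren, subst, ihV, ihW, ih]
    congr 2; funext x; cases x <;> rfl
  | _ => simp_all [ren, subst]

theorem ren_ren (f g : ℕ → ℕ) (t : Anf P K) : ren g (ren f t) = ren (g ∘ f) t := by
  rw [ren_eq_subst g, subst_ren, ren_eq_subst]; rfl

theorem up_ren (f : ℕ → ℕ) (s : ℕ → Anf P K) :
    up (fun x => ren f (s x)) = fun x => ren (liftRen f) (up s x) := by
  funext x; cases x
  · rfl
  · simp only [up_succ, ren_ren]; rfl

theorem ren_subst (f : ℕ → ℕ) (s : ℕ → Anf P K) (t : Anf P K) :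
    ren f (subst s t) = subst (fun x => ren f (s x)) t := by
  induction t generalizing f s <;> simp_all [ren, subst, up_ren]

theorem up_subst (s s' : ℕ → Anf P K) :
    up (fun x => subst s' (s x)) = fun x => subst (up s') (up s x) := by
  funext x; cases x
  · rfl
  · simp only [up_succ, subst_ren, ren_subst]

theorem subst_subst (s s' : ℕ → Anf P K) (t : Anf P K) :
    subst s' (subst s t) = subst (fun x => subst s' (s x)) t := by
  induction t generalizing s s' <;> simp_all [subst, up_subst]

theorem ren_succ_subst_scons (v : Anf P K) (s : ℕ → Anf P K) (t : Anf P K) :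
    subst (scons v s) (ren Nat.succ t) = subst s t := subst_ren _ _ _

theorem ren_succ_subst_up (s : ℕ → Anf P K) (t : Anf P K) :
    subst (up s) (ren Nat.succ t) = ren Nat.succ (subst s t) := by
  rw [subst_ren, ren_subst]; rfl

theorem ren_succ_injective : Function.Injective (ren (P := P) (K := K) Nat.succ) := by
  intro s t h
  have := congrArg (ren Nat.pred) h
  rw [ren_ren, ren_ren] at this
  have e : Nat.pred ∘ Nat.succ = id := rfl
  simpa [e] using this

theorem ren_liftRen_succ (f : ℕ → ℕ) (t : Anf P K) :
    ren (liftRen f) (ren Nat.succ t) = ren Nat.succ (ren f t) := by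
  rw [ren_ren, ren_ren]; rfl

theorem subst_scons_subst (v : Anf P K) (s s' : ℕ → Anf P K) (t : Anf P K) :
    subst s' (subst (scons v s) t) = subst (scons (subst s' v) fun x => subst s' (s x)) t := by
  rw [subst_subst]; congr 1; funext x; cases x <;> rfl

theorem subst_scons_up (v : Anf P K) (s s' : ℕ → Anf P K) (t : Anf P K) :
    subst (scons v s') (subst (up s) t) = subst (scons v fun x => subst s' (s x)) t := by
  rw [subst_subst]; congr 1; funext x; cases x
  · rfl
  · simp [ren_succ_subst_scons]

/-- Terms other than `call`. -/
def Pure : Anf P K → Prop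
  | call _ _ _ => False
  | _ => True

theorem Pure.ren {t : Anf P K} (h : Pure t) (f : ℕ → ℕ) : Pure (t.ren f) := by
  cases t <;> simp_all [Pure, Anf.ren]

theorem Pure.subst {t : Anf P K} (h : Pure t) {s : ℕ → Anf P K} (hs : ∀ x, Pure (s x)) :
    Pure (t.subst s) := by
  cases t <;> simp_all [Pure, Anf.subst]

theorem Pure.up {s : ℕ → Anf P K} (hs : ∀ x, Pure (s x)) (x : ℕ) : Pure (up s x) := by
  cases x
  · trivial
  · exact (hs _).ren _

theorem Pure.scons {v : Anf P K} {s : ℕ → Anf P K} (hv : Pure v) (hs : ∀ x, Pure (s x)) (x : ℕ) :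
    Pure (scons v s x) := by
  cases x
  · exact hv
  · exact hs _

-- Sequencing

/-- Sequencing: the continuation `k` receives the result of `t` and the weakening from the scope
of `t` to the scope of the result. -/
def bindK : Anf P K → ((ℕ → ℕ) → Anf P K → Anf P K) → Anf P K
  | call V W N, k => call V W (bindK N fun f => k (f ∘ Nat.succ))
  | v, k => k id v

/-- `let x = t in N`, with nested bindings flattened. -/
def bind (t N : Anf P K) : Anf P K := bindK t fun f v => N.subst (scons v fun x => var (f x))

theorem bindK_pure {v : Anf P K} (h : Pure v) (k) : bindK v k = k id v := by
  cases v <;> first | rfl | exact h.elim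

theorem bindK_congr {R : Anf P K → Anf P K → Prop}
    (hR : ∀ V W N N', R N N' → R (call V W N) (call V W N')) {t : Anf P K}
    {k k' : (ℕ → ℕ) → Anf P K → Anf P K} (h : ∀ f v, Pure v → R (k f v) (k' f v)) :
    R (bindK t k) (bindK t k') := by
  induction t generalizing k k' with
  | call V W N _ _ ih => exact hR _ _ _ _ (ih fun f v hv => h _ v hv)
  | _ => exact h _ _ trivial

theorem bindK_congr_eq {t : Anf P K} {k k' : (ℕ → ℕ) → Anf P K → Anf P K}
    (h : ∀ f v, Pure v → k f v = k' f v) : bindK t k = bindK t k' :=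
  bindK_congr (R := Eq) (fun _ _ _ _ h => by rw [h]) h

theorem bindK_bindK (t : Anf P K) (k k' : (ℕ → ℕ) → Anf P K → Anf P K) :
    bindK (bindK t k) k' = bindK t fun f v => bindK (k f v) fun g => k' (g ∘ f) := by
  induction t generalizing k k' with
  | call V W N _ _ ih => simp only [bindK, ih]; rfl
  | _ => rfl

/-- Crossing a `call` lifts `s` and lengthens the weakening by one. The relation between `h`, `g`,
`g'` and `s` says that `h` is `s` as seen below the bindings crossed so far. Purity of `s` ensures
that substituting for the result does not add further calls to the sequence. -/
theorem subst_bindK {t : Anf P K} {k k' : (ℕ → ℕ) → Anf P K → Anf P K} {s : ℕ → Anf P K}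
    (hs : ∀ x, Pure (s x))
    (h : ∀ g g' h, (∀ x, Pure (h x)) → (∀ x, h (g x) = (s x).ren g') → ∀ v, Pure v →
      (k g v).subst h = k' g' (v.subst h)) :
    (bindK t k).subst s = bindK (t.subst s) k' := by
  induction t generalizing k k' s with
  | call V W N _ _ ih =>
    simp only [bindK, subst]
    rw [ih (k' := fun f => k' (f ∘ Nat.succ)) (Pure.up hs)]
    intro g g' j hj e v hv
    refine h _ _ _ hj (fun x => ?_) v hv
    have := e (x + 1)
    rwa [up_succ, ren_ren] at this
  | var x => exact (h id id s hs (by simp) (var x) trivial).trans (bindK_pure (hs x) k').symm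
  | const c => exact h id id s hs (by simp) (const c) trivial
  | lam σ N => exact h id id s hs (by simp) (lam σ N) trivial
  | box as M => exact h id id s hs (by simp) (box as M) trivial
  | nil => exact h id id s hs (by simp) nil trivial
  | cons σ V as => exact h id id s hs (by simp) (cons σ V as) trivial

theorem subst_bind (t N : Anf P K) {s : ℕ → Anf P K} (hs : ∀ x, Pure (s x)) :
    (bind t N).subst s = bind (t.subst s) (N.subst (up s)) := by
  refine subst_bindK hs fun g g' j hj e v hv => ?_
  rw [subst_subst, subst_subst]
  congr 1; funext x; cases x
  · rfl
  · simp only [scons_succ, subst, e, up_succ, ren_succ_subst_scons]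
    exact ren_eq_subst _ _

theorem ren_bind (t N : Anf P K) (f : ℕ → ℕ) :
    (bind t N).ren f = bind (t.ren f) (N.ren (liftRen f)) := by
  have h : ∀ x, Pure (var (f x) : Anf P K) := fun _ => trivial
  rw [ren_eq_subst, subst_bind _ _ h, up_comp_var, ← ren_eq_subst, ← ren_eq_subst]

theorem bind_pure {v : Anf P K} (h : Pure v) (N : Anf P K) :
    bind v N = N.subst (scons v var) := bindK_pure h _

theorem bind_var_zero (t : Anf P K) : bind t (var 0) = t := by
  unfold bind
  simp only [subst, scons_zero]
  induction t with
  | call V W N _ _ ih => simp only [bindK]; rw [ih]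
  | _ => rfl

theorem bind_call (V W N N' : Anf P K) :
    bind (call V W N) N' = call V W (bind N (N'.ren (liftRen Nat.succ))) := by
  unfold bind
  simp only [bindK, subst_ren]
  congr 2; funext f v; congr 1; funext x; cases x <;> rfl

/-- Continuations that commute with substitution. -/
def Natural (k : (ℕ → ℕ) → Anf P K → Anf P K) : Prop :=
  ∀ g g' h, (∀ x, Pure (h x)) → (∀ x, h (g x) = var (g' x)) → ∀ v, Pure v →
    (k g v).subst h = k g' (v.subst h)

theorem bind_bindK (t N : Anf P K) {k : (ℕ → ℕ) → Anf P K → Anf P K} (hk : Natural k) :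
    bind t (bindK N fun f => k (f ∘ Nat.succ)) = bindK (bind t N) k := by
  rw [bind, bind, bindK_bindK]
  refine bindK_congr_eq fun f v hv => ?_
  refine subst_bindK (Pure.scons hv fun _ => trivial) fun g g' j hj e w hw => ?_
  exact hk _ _ _ hj (fun x => e (x + 1)) w hw

theorem natural_subst (N : Anf P K) :
    Natural fun f v => N.subst (scons v fun x => var (f x)) := by
  intro g g' h _ e v _
  rw [subst_scons_subst]
  simp [subst, e]

/-- Both sides run `t`, `N` and `N'` in this order. This makes `comp` an identity, as
`bind_var_zero` does for `id_let` and `bind_pure` for `beta_let`. -/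
theorem bind_assoc (t N N' : Anf P K) :
    bind (bind t N) N' = bind t (bind N (N'.ren (liftRen Nat.succ))) := by
  rw [bind, ← bind_bindK _ _ (natural_subst N'), bind, bind, bind]
  simp only [subst_ren]
  congr; funext f v; congr; funext f v; congr; funext x; cases x <;> rfl

-- Argument lists

/-- Concatenation of argument lists. -/
def append : Anf P K → Anf P K → Anf P K
  | cons σ V as, bs => cons σ V (append as bs)
  | _, bs => bs

/-- The length of an argument list. -/
def len : Anf P K → ℕ
  | cons _ _ as => len as + 1
  | _ => 0

@[simp] theorem len_ren (f : ℕ → ℕ) (as : Anf P K) : len (as.ren f) = len as := by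
  induction as <;> simp_all [len, ren]

theorem ren_append (f : ℕ → ℕ) (as bs : Anf P K) :
    (append as bs).ren f = append (as.ren f) (bs.ren f) := by
  induction as <;> simp_all [append, ren]

/-- Argument lists. -/
def Spine : Anf P K → Prop
  | nil => True
  | cons _ _ as => Spine as
  | _ => False

theorem Spine.pure {as : Anf P K} (h : Spine as) : Pure as := by
  cases as <;> simp_all [Spine, Pure]

theorem Spine.subst {as : Anf P K} (h : Spine as) (s : ℕ → Anf P K) : Spine (as.subst s) := by
  induction as <;> simp_all [Spine, Anf.subst]

theorem Spine.ren {as : Anf P K} (h : Spine as) (f : ℕ → ℕ) : Spine (as.ren f) := by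
  rw [ren_eq_subst]; exact h.subst _

theorem Spine.len_subst {as : Anf P K} (h : Spine as) (s : ℕ → Anf P K) :
    len (as.subst s) = len as := by
  induction as <;> simp_all [len, Anf.subst, Spine]

theorem Spine.subst_append {as : Anf P K} (h : Spine as) (s : ℕ → Anf P K) (bs : Anf P K) :
    (append as bs).subst s = append (as.subst s) (bs.subst s) := by
  induction as <;> simp_all [append, Anf.subst, Spine]

theorem Spine.append_assoc {as : Anf P K} (h : Spine as) (bs cs : Anf P K) :
    Anf.append (Anf.append as bs) cs = Anf.append as (Anf.append bs cs) := by
  induction as <;> simp_all [Anf.append, Spine]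

theorem Spine.len_append {as : Anf P K} (h : Spine as) (bs : Anf P K) :
    len (Anf.append as bs) = len as + len bs := by
  induction as <;> simp_all [Anf.append, Spine, len]; omega

theorem Spine.append_nil {as : Anf P K} (h : Spine as) : Anf.append as nil = as := by
  induction as <;> simp_all [Anf.append, Spine]

theorem Pure.append {as bs : Anf P K} (h : Pure bs) : Pure (append as bs) := by
  cases as <;> simp_all [Anf.append, Pure]

-- Parallel reduction

/-- Parallel reduction. For argument lists, `Par as as' θ` also yields the substitution `θ` from the
scope bound by `as` to the scope bound by `as'`; for all other terms `θ` is `var`. -/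
inductive Par : Anf P K → Anf P K → (ℕ → Anf P K) → Prop
  | const (c : K) : Par (const c) (const c) var
  | var (x : ℕ) : Par (var x) (var x) var
  | lam {N N' : Anf P K} (σ : Ty P) : Par N N' var → Par (lam σ N) (lam σ N') var
  | call {V V' W W' N N' : Anf P K} :
      Par V V' var → Par W W' var → Par N N' var → Par (call V W N) (call V' W' N') var
  | beta {V W W' N N' Q : Anf P K} {σ : Ty P} : Par V (lam σ Q) var → Par W W' var → Par N N' var →
      Pure W → Par (call V W N) (bind (Q.subst (scons W' var)) N') var
  | eta {V V' : Anf P K} (σ : Ty P) : Pure V → Par V V' var →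
      Par (lam σ (call (V.ren Nat.succ) (var 0) (var 0))) V' var
  | box {as as' M M' : Anf P K} {θ : ℕ → Anf P K} : Par as as' θ → Par M M' var →
      Par (box as M) (box as' (M'.subst θ)) var
  | idBox {V V' : Anf P K} (σ : Ty P) : Pure V → Par V V' var →
      Par (box (cons σ V nil) (var 0)) V' var
  | nil : Par nil nil var
  | keep {V V' as as' : Anf P K} {θ : ℕ → Anf P K} (σ : Ty P) : Par V V' var → Par as as' θ →
      Par (cons σ V as) (cons σ V' as') (up θ)
  | flat {V ns U as as' : Anf P K} {θ : ℕ → Anf P K} (σ : Ty P) : Par V (box ns U) var →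
      Par as as' θ → Spine ns → Pure as →
      Par (cons σ V as) (append ns as') (scons U fun j => (θ j).ren (· + len ns))

theorem ren_subst_single (f : ℕ → ℕ) (t v : Anf P K) :
    (t.subst (scons v var)).ren f = (t.ren (liftRen f)).subst (scons (v.ren f) var) := by
  rw [ren_subst, subst_ren]
  congr 1; funext x; cases x <;> rfl

theorem subst_subst_single (s : ℕ → Anf P K) (t v : Anf P K) :
    (t.subst (scons v var)).subst s = (t.subst (up s)).subst (scons (v.subst s) var) := by
  rw [subst_scons_subst, subst_scons_up]
  simp [subst]

theorem Par.refl (t : Anf P K) : Par t t Anf.var := by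
  induction t with
  | const c => exact .const c
  | var x => exact .var x
  | lam σ N ih => exact .lam σ ih
  | call V W N ihV ihW ih => exact .call ihV ihW ih
  | box as M iha ihM => simpa using Par.box iha ihM
  | nil => exact .nil
  | cons σ V as ihV iha => simpa [up_var] using Par.keep σ ihV iha

theorem Par.pure {t t' : Anf P K} {θ : ℕ → Anf P K} (h : Par t t' θ) (ht : Pure t) : Pure t' := by
  induction h with
  | call | beta => exact ht.elim
  | eta σ hV _ ih => exact ih hV
  | idBox σ hV _ ih => exact ih hV
  | flat σ _ _ _ ha _ ih => exact (ih ha).append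
  | _ => trivial

/-- `θ` is untouched because it acts on the variables bound by a box, and a box body sees no others.
-/
theorem Par.ren {t t' : Anf P K} {θ : ℕ → Anf P K} (h : Par t t' θ) (f : ℕ → ℕ) :
    Par (t.ren f) (t'.ren f) θ := by
  induction h generalizing f with
  | const c => exact .const c
  | var x => exact .var _
  | lam σ _ ih => exact .lam σ (ih _)
  | call _ _ _ ihV ihW ih => exact .call (ihV _) (ihW _) (ih _)
  | @beta V W W' N N' Q σ _ _ _ hW ihV ihW ih =>
    have := Par.beta (ihV f) (ihW f) (ih (liftRen f)) (hW.ren f)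
    rwa [← ren_subst_single, ← ren_bind] at this
  | eta σ hV _ ih =>
    have := Par.eta σ (hV.ren f) (ih f)
    rwa [← ren_liftRen_succ] at this
  | box _ _ iha ihM => exact .box (iha f) (by assumption)
  | idBox σ hV _ ih => exact .idBox σ (hV.ren f) (ih f)
  | nil => exact .nil
  | keep σ _ _ ihV iha => exact .keep σ (ihV f) (iha f)
  | flat σ _ _ hn ha ihV iha =>
    have := Par.flat σ (ihV f) (iha f) (hn.ren f) (ha.ren f)
    rwa [len_ren, ← ren_append] at this

theorem Par.up {s s' : ℕ → Anf P K} (h : ∀ x, Par (s x) (s' x) Anf.var) (x : ℕ) :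
    Par (up s x) (up s' x) Anf.var := by
  cases x
  · exact .refl _
  · exact (h _).ren _

theorem Par.scons {v v' : Anf P K} {s s' : ℕ → Anf P K} (hv : Par v v' Anf.var)
    (h : ∀ x, Par (s x) (s' x) Anf.var) (x : ℕ) : Par (scons v s x) (scons v' s' x) Anf.var := by
  cases x
  · exact hv
  · exact h _

/-- Purity of `s` keeps the side conditions of `beta`, `eta`, `idBox` and `flat` true after
substitution; the purity of `s'` that follows lets the substitution pass through the `bind` in a
β-contractum. -/
theorem Par.subst {t t' : Anf P K} {θ : ℕ → Anf P K} (h : Par t t' θ) {s s' : ℕ → Anf P K}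
    (hp : ∀ x, Pure (s x)) (hs : ∀ x, Par (s x) (s' x) Anf.var) :
    Par (t.subst s) (t'.subst s') θ := by
  induction h generalizing s s' with
  | const c => exact .const c
  | var x => exact hs x
  | lam σ _ ih => exact .lam σ (ih (Pure.up hp) (Par.up hs))
  | call _ _ _ ihV ihW ih =>
    exact .call (ihV hp hs) (ihW hp hs) (ih (Pure.up hp) (Par.up hs))
  | @beta V W W' N N' Q σ _ hWW _ hW ihV ihW ih =>
    have := Par.beta (ihV hp hs) (ihW hp hs) (ih (Pure.up hp) (Par.up hs)) (hW.subst hp)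
    rwa [← subst_subst_single, ← subst_bind _ _ fun x => (hs x).pure (hp x)] at this
  | eta σ hV _ ih =>
    have := Par.eta σ (hV.subst hp) (ih hp hs)
    rwa [← ren_succ_subst_up] at this
  | box _ _ iha ihM => exact .box (iha hp hs) (by assumption)
  | idBox σ hV _ ih => exact .idBox σ (hV.subst hp) (ih hp hs)
  | nil => exact .nil
  | keep σ _ _ ihV iha => exact .keep σ (ihV hp hs) (iha hp hs)
  | flat σ _ _ hn ha ihV iha =>
    have := Par.flat σ (ihV hp hs) (iha hp hs) (hn.subst s') (ha.subst hp)
    rwa [hn.len_subst, ← hn.subst_append] at this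

/-- Induction along the calls of `N`. When the head call is contracted, the reduct is itself a
`bind`; naturality of `k'` lets `bind_bindK` move the continuation behind the contracted function
body, so that a single `beta` applies. -/
theorem Par.bindK {N N' : Anf P K} (h : Par N N' Anf.var) {k k' : (ℕ → ℕ) → Anf P K → Anf P K}
    (hk : Natural k')
    (hkk : ∀ f v v', Pure v → Par v v' Anf.var → Par (k f v) (k' f v') Anf.var) :
    Par (bindK N k) (bindK N' k') Anf.var := by
  induction N generalizing N' k k' with
  | call V W N _ _ ih =>
    have hk' : Natural fun f => k' (f ∘ Nat.succ) := fun g g' j hj e v hv =>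
      hk _ _ j hj (fun x => e (x + 1)) v hv
    cases h with
    | call hV hW hN => exact .call hV hW (ih hN hk' fun f => hkk _)
    | beta hV hW hN hp =>
      rw [← bind_bindK _ _ hk]
      exact .beta hV hW (ih hN hk' fun f => hkk _) hp
  | _ =>
    rw [bindK_pure (by trivial), bindK_pure (h.pure (by trivial))]
    exact hkk _ _ _ (by trivial) h

theorem Par.bind {t t' N N' : Anf P K} (h : Par t t' Anf.var) (hN : Par N N' Anf.var) :
    Par (bind t N) (bind t' N') Anf.var :=
  h.bindK (natural_subst N') fun _ _ _ hv hvv =>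
    hN.subst (Pure.scons hv fun _ => trivial) (Par.scons hvv fun _ => .refl _)

/-- Parallel reduction does not create free variables. -/
theorem Par.ren_eq_ren {t t' : Anf P K} {θ : ℕ → Anf P K} (h : Par t t' θ) {f g : ℕ → ℕ}
    (e : t.ren f = t.ren g) : t'.ren f = t'.ren g := by
  induction h generalizing f g with
  | const | nil => rfl
  | var x => exact e
  | lam σ _ ih =>
    simp only [Anf.ren, lam.injEq, true_and] at e ⊢
    exact ih e
  | call _ _ _ ihV ihW ih =>
    simp only [Anf.ren, call.injEq] at e ⊢
    exact ⟨ihV e.1, ihW e.2.1, ih e.2.2⟩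
  | @beta V W W' N N' Q σ _ _ _ hW ihV ihW ih =>
    simp only [Anf.ren, call.injEq] at e
    have hV := ihV e.1
    simp only [Anf.ren, lam.injEq, true_and] at hV
    rw [ren_bind, ren_bind, ren_subst_single, ren_subst_single, hV, ihW e.2.1, ih e.2.2]
  | eta σ hV _ ih =>
    simp only [Anf.ren, lam.injEq, call.injEq, ren_liftRen_succ, true_and] at e
    exact ih (ren_succ_injective e.1)
  | box _ _ iha ihM =>
    simp only [Anf.ren, box.injEq, and_true] at e ⊢
    exact iha e
  | idBox σ hV _ ih =>
    simp only [Anf.ren, box.injEq, and_true, cons.injEq, true_and] at e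
    exact ih e
  | keep σ _ _ ihV iha =>
    simp only [Anf.ren, cons.injEq, true_and] at e ⊢
    exact ⟨ihV e.1, iha e.2⟩
  | flat σ _ _ hn ha ihV iha =>
    simp only [Anf.ren, cons.injEq, true_and] at e
    have hV := ihV e.1
    simp only [Anf.ren, box.injEq, and_true] at hV
    rw [ren_append, ren_append, hV, iha e.2]

/-- `Nat.pred` undoes `Nat.succ`. The weakened term is fixed by the renaming `Nat.succ ∘ Nat.pred`,
hence so is its reduct, as no free variables are created; renaming the whole reduction by `Nat.pred`
gives the reduction of `t`. -/
theorem Par.of_ren_succ {t u : Anf P K} (h : Par (t.ren Nat.succ) u Anf.var) :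
    ∃ t', u = t'.ren Nat.succ ∧ Par t t' Anf.var := by
  refine ⟨u.ren Nat.pred, ?_, ?_⟩
  · have := h.ren_eq_ren (f := id) (g := Nat.succ ∘ Nat.pred) (by
      rw [ren_ren, ren_ren]; rfl)
    rwa [ren_id, ← ren_ren] at this
  · have := h.ren Nat.pred
    rw [ren_ren] at this
    exact (ren_id t) ▸ this

end Anf
end LambdaBox

-- Typing and subject reduction

namespace LambdaBox

open Term (liftRen)

namespace Anf

variable {P K : Type*}

/-- The judgements on `Anf`: values of a type, terms of a type, argument lists for a scope. -/
inductive Kind (P : Type*) where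
  | val (τ : Ty P) : Kind P
  | comp (τ : Ty P) : Kind P
  | args (σs : List (Ty P)) : Kind P

open Kind

/-- Typing of `Anf`. -/
inductive HasT (tc : K → Ty P) : List (Ty P) → Anf P K → Kind P → Prop
  | const (Γ : List (Ty P)) (c : K) : HasT tc Γ (const c) (val (tc c))
  | var {Γ : List (Ty P)} {x : ℕ} {τ : Ty P} : Γ[x]? = some τ → HasT tc Γ (var x) (val τ)
  | lam {Γ : List (Ty P)} {σ τ : Ty P} {N : Anf P K} :
      HasT tc (σ :: Γ) N (comp τ) → HasT tc Γ (lam σ N) (val (.imp σ τ))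
  | ret {Γ : List (Ty P)} {τ : Ty P} {V : Anf P K} : HasT tc Γ V (val τ) → HasT tc Γ V (comp τ)
  | call {Γ : List (Ty P)} {σ τ ρ : Ty P} {V W N : Anf P K} : HasT tc Γ V (val (.imp σ τ)) →
      HasT tc Γ W (val σ) → HasT tc (τ :: Γ) N (comp ρ) → HasT tc Γ (call V W N) (comp ρ)
  | box {Γ σs : List (Ty P)} {τ : Ty P} {as M : Anf P K} :
      HasT tc Γ as (args σs) → HasT tc σs M (val τ) → HasT tc Γ (box as M) (val (.nec τ))
  | nil (Γ : List (Ty P)) : HasT tc Γ nil (args [])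
  | cons {Γ σs : List (Ty P)} {σ : Ty P} {V as : Anf P K} : HasT tc Γ V (val (.nec σ)) →
      HasT tc Γ as (args σs) → HasT tc Γ (cons σ V as) (args (σ :: σs))

variable {tc : K → Ty P} {Γ Δ : List (Ty P)} {t : Anf P K}

theorem HasT.pure {τ : Ty P} (h : HasT tc Γ t (val τ)) : Pure t := by
  cases h <;> trivial

theorem HasT.val_of_pure {τ : Ty P} (h : HasT tc Γ t (comp τ)) (ht : Pure t) :
    HasT tc Γ t (val τ) := by
  cases h
  · assumption
  · exact ht.elim

theorem HasT.spine {σs : List (Ty P)} (h : HasT tc Γ t (args σs)) : Spine t := by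
  induction t generalizing σs with
  | nil => trivial
  | cons σ V as _ ih => cases h with | cons _ h => exact ih h
  | _ => cases h

theorem HasT.len_eq {σs : List (Ty P)} (h : HasT tc Γ t (args σs)) : len t = σs.length := by
  induction t generalizing σs with
  | nil => cases h; rfl
  | cons σ V as _ ih => cases h with | cons _ h => simp [len, ih h]
  | _ => cases h

theorem HasT.append {as bs : Anf P K} {σs τs : List (Ty P)} (h : HasT tc Γ as (args σs))
    (h' : HasT tc Γ bs (args τs)) : HasT tc Γ (append as bs) (args (σs ++ τs)) := by
  induction as generalizing σs with
  | nil => cases h; exact h'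
  | cons σ V as _ ih => cases h with | cons hV h => exact .cons hV (ih h)
  | _ => cases h

theorem getElem?_liftRen {f : ℕ → ℕ} (hf : ∀ x (τ : Ty P), Γ[x]? = some τ → Δ[f x]? = some τ)
    (σ : Ty P) (x : ℕ) (τ : Ty P) (h : (σ :: Γ)[x]? = some τ) :
    (σ :: Δ)[liftRen f x]? = some τ := by
  cases x
  · exact h
  · exact hf _ _ h

theorem HasT.ren {κ : Kind P} (h : HasT tc Γ t κ) {f : ℕ → ℕ}
    (hf : ∀ x (τ : Ty P), Γ[x]? = some τ → Δ[f x]? = some τ) : HasT tc Δ (t.ren f) κ := by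
  induction h generalizing f Δ with
  | const Γ c => exact .const _ c
  | var h => exact .var (hf _ _ h)
  | lam _ ih => exact .lam (ih (getElem?_liftRen hf _))
  | ret _ ih => exact .ret (ih hf)
  | call _ _ _ ihV ihW ih => exact .call (ihV hf) (ihW hf) (ih (getElem?_liftRen hf _))
  | box _ _ iha _ => exact .box (iha hf) (by assumption)
  | nil => exact .nil _
  | cons _ _ ihV iha => exact .cons (ihV hf) (iha hf)

/-- Strengthening, which η needs because it discards a bound variable. -/
theorem HasT.of_ren {κ : Kind P} {f : ℕ → ℕ} (h : HasT tc Δ (t.ren f) κ)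
    (hf : ∀ x, Δ[f x]? = Γ[x]?) : HasT tc Γ t κ := by
  have lift {f : ℕ → ℕ} {Γ Δ : List (Ty P)} (hf : ∀ x, Δ[f x]? = Γ[x]?) (σ : Ty P) (x : ℕ) :
      (σ :: Δ)[liftRen f x]? = (σ :: Γ)[x]? := by
    cases x
    · rfl
    · exact hf _
  generalize e : t.ren f = u at h
  induction h generalizing t f Γ with
  | ret _ ih => exact .ret (ih hf e)
  | const _ c => cases t <;> simp only [Anf.ren, reduceCtorEq] at e; cases e; exact .const _ _
  | var h => cases t <;> simp only [Anf.ren, reduceCtorEq] at e; cases e; exact .var (hf _ ▸ h)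
  | lam _ ih =>
    cases t <;> simp only [Anf.ren, reduceCtorEq] at e
    cases e; exact .lam (ih (lift hf _) rfl)
  | call _ _ _ ihV ihW ih =>
    cases t <;> simp only [Anf.ren, reduceCtorEq] at e
    cases e; exact .call (ihV hf rfl) (ihW hf rfl) (ih (lift hf _) rfl)
  | box _ _ iha ihM =>
    cases t <;> simp only [Anf.ren, reduceCtorEq] at e
    cases e; exact .box (iha hf rfl) (by assumption)
  | nil => cases t <;> simp only [Anf.ren, reduceCtorEq] at e; exact .nil _
  | cons _ _ ihV iha =>
    cases t <;> simp only [Anf.ren, reduceCtorEq] at e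
    cases e; exact .cons (ihV hf rfl) (iha hf rfl)

theorem HasT.eta_inv {σ τ : Ty P} {V : Anf P K}
    (h : HasT tc (σ :: Γ) (Anf.call (V.ren Nat.succ) (Anf.var 0) (Anf.var 0)) (comp τ)) :
    HasT tc Γ V (val (.imp σ τ)) := by
  cases h with
  | ret h => cases h
  | call hV h0 h1 =>
  cases h0 with
  | var h0 =>
  cases h1 with
  | ret h1 =>
  cases h1 with
  | var h1 =>
  cases h0; cases h1
  exact hV.of_ren fun _ => rfl

theorem HasT.ren_succ {κ : Kind P} (h : HasT tc Γ t κ) (σ : Ty P) :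
    HasT tc (σ :: Γ) (t.ren Nat.succ) κ := h.ren fun _ _ h => h

theorem HasT.weaken {κ : Kind P} (h : HasT tc Γ t κ) : HasT tc (Γ ++ Δ) t κ := by
  rw [← ren_id t]
  refine h.ren fun x τ hx => ?_
  rw [id, List.getElem?_append_left (List.getElem?_eq_some_iff.1 hx).1, hx]

theorem HasT.up {s : ℕ → Anf P K} (hs : ∀ x τ, Γ[x]? = some τ → HasT tc Δ (s x) (val τ))
    (σ : Ty P) (x : ℕ) (τ : Ty P) (h : (σ :: Γ)[x]? = some τ) :
    HasT tc (σ :: Δ) (up s x) (val τ) := by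
  cases x
  · exact .var h
  · exact (hs _ _ h).ren_succ σ

theorem HasT.scons {s : ℕ → Anf P K} {v : Anf P K} {σ : Ty P} (hv : HasT tc Δ v (val σ))
    (hs : ∀ x τ, Γ[x]? = some τ → HasT tc Δ (s x) (val τ)) (x : ℕ) (τ : Ty P)
    (h : (σ :: Γ)[x]? = some τ) : HasT tc Δ (scons v s x) (val τ) := by
  cases x
  · cases h; exact hv
  · exact hs _ _ h

theorem HasT.subst {κ : Kind P} (h : HasT tc Γ t κ) {s : ℕ → Anf P K}
    (hs : ∀ x τ, Γ[x]? = some τ → HasT tc Δ (s x) (val τ)) : HasT tc Δ (t.subst s) κ := by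
  induction h generalizing s Δ with
  | const Γ c => exact .const _ c
  | var h => exact hs _ _ h
  | lam _ ih => exact .lam (ih (HasT.up hs _))
  | ret _ ih => exact .ret (ih hs)
  | call _ _ _ ihV ihW ih => exact .call (ihV hs) (ihW hs) (ih (HasT.up hs _))
  | box _ _ iha _ => exact .box (iha hs) (by assumption)
  | nil => exact .nil _
  | cons _ _ ihV iha => exact .cons (ihV hs) (iha hs)

/-- A typed term mentions only indices of its context. This is how substitutions are compared when
they are controlled only on the variables bound by a box. -/
theorem HasT.subst_congr {κ : Kind P} (h : HasT tc Γ t κ) {s s' : ℕ → Anf P K}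
    (hs : ∀ x < Γ.length, s x = s' x) : t.subst s = t.subst s' := by
  have lift {s s' : ℕ → Anf P K} {Γ : List (Ty P)} (hs : ∀ x < Γ.length, s x = s' x) (σ : Ty P)
      (x : ℕ) (hx : x < (σ :: Γ).length) : Anf.up s x = Anf.up s' x := by
    cases x
    · rfl
    · simp only [up_succ]; rw [hs _ (by simpa using hx)]
  induction h generalizing s s' with
  | const | nil => rfl
  | var h => exact hs _ (List.getElem?_eq_some_iff.1 h).1
  | lam _ ih => simp only [Anf.subst]; rw [ih (lift hs _)]
  | ret _ ih => exact ih hs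
  | call _ _ _ ihV ihW ih => simp only [Anf.subst]; rw [ihV hs, ihW hs, ih (lift hs _)]
  | box _ _ iha _ => simp only [Anf.subst]; rw [iha hs]
  | cons _ _ ihV iha => simp only [Anf.subst]; rw [ihV hs, iha hs]

theorem HasT.bindK {τ : Ty P} {κ : Kind P} (hκ : ∃ ρ, κ = comp ρ) (h : HasT tc Γ t (comp τ))
    {k : (ℕ → ℕ) → Anf P K → Anf P K}
    (hk : ∀ f v Δ, (∀ x τ, Γ[x]? = some τ → Δ[f x]? = some τ) → HasT tc Δ v (val τ) →
      HasT tc Δ (k f v) κ) : HasT tc Γ (bindK t k) κ := by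
  obtain ⟨ρ, rfl⟩ := hκ
  induction t generalizing k Γ with
  | call V W N _ _ ih =>
    cases h with
    | ret h => cases h
    | call hV hW hN =>
      exact .call hV hW (ih hN fun f v Δ hf hv => hk _ _ _ (fun x τ hx => hf _ _ hx) hv)
  | _ => exact hk _ _ _ (fun _ _ h => h) (h.val_of_pure trivial)

theorem HasT.bind {σ τ : Ty P} {N : Anf P K} (h : HasT tc Γ t (comp σ))
    (hN : HasT tc (σ :: Γ) N (comp τ)) : HasT tc Γ (bind t N) (comp τ) :=
  h.bindK ⟨_, rfl⟩ fun _ _ _ hf hv => hN.subst (HasT.scons hv fun _ _ hx => .var (hf _ _ hx))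

/-- The judgement preserved by `Par t t' θ`, as a property of `t'` and `θ`. -/
def Reduct (tc : K → Ty P) (Γ : List (Ty P)) (t : Anf P K) (θ : ℕ → Anf P K) : Kind P → Prop
  | args σs => ∃ σs', HasT tc Γ t (args σs') ∧
      ∀ x τ, σs[x]? = some τ → HasT tc σs' (θ x) (val τ)
  | κ => HasT tc Γ t κ

/-- Subject reduction. -/
theorem HasT.reduct {κ : Kind P} (h : HasT tc Γ t κ) {t' : Anf P K} {θ : ℕ → Anf P K}
    (hp : Par t t' θ) : Reduct tc Γ t' θ κ := by
  induction h generalizing t' θ with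
  | const Γ c => cases hp; exact .const _ _
  | var h => cases hp; exact .var h
  | lam hN ih =>
    cases hp with
    | lam _ hp => exact .lam (ih hp)
    | eta _ _ hp =>
      -- The body before contraction also reduces, by congruence, to `V'` applied to the bound
      -- variable; the induction hypothesis types that body.
      exact HasT.eta_inv (ih (.call (hp.ren Nat.succ) (.refl (Anf.var 0)) (.refl (Anf.var 0))))
  | ret _ ih => exact .ret (ih hp)
  | call _ _ _ ihV ihW ih =>
    cases hp with
    | call hV hW hN => exact .call (ihV hV) (ihW hW) (ih hN)
    | beta hV hW hN =>
      cases ihV hV with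
      | lam hQ => exact (hQ.subst (HasT.scons (ihW hW) fun _ _ => .var)).bind (ih hN)
  | box _ hM0 iha ihM =>
    cases hp with
    | box ha hM =>
      obtain ⟨σs', h, hθ⟩ := iha ha
      exact .box h ((ihM hM : HasT tc _ _ (val _)).subst hθ)
    | idBox σ _ hp =>
      -- Keeping the single argument is a reduction of the argument list, so the hypothesis for the
      -- list types `V'`; the type of the body variable then identifies the two types.
      obtain ⟨σs', h, hθ⟩ := iha (.keep σ hp .nil)
      cases hM0 with
      | var hM =>
      cases h with
      | cons hV h =>
      cases h with
      | nil =>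
      cases hθ _ _ hM with
      | var h => cases h; exact hV
  | nil => cases hp; exact ⟨[], .nil _, fun _ _ h => by simp at h⟩
  | cons _ _ ihV iha =>
    cases hp with
    | keep _ hV ha =>
      obtain ⟨σs', h, hθ⟩ := iha ha
      exact ⟨_, .cons (ihV hV) h, HasT.up hθ _⟩
    | flat _ hV ha _ _ =>
      obtain ⟨σs', h, hθ⟩ := iha ha
      cases ihV hV with
      | box hn hU =>
        -- `U` uses only the initial variables coming from `ns`, so it is weakened at the end of the
        -- context; the substitutes for later arguments are shifted past those variables.
        refine ⟨_, hn.append h, HasT.scons hU.weaken fun x τ hx => (hθ x τ hx).ren fun y ρ hy => ?_⟩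
        rw [hn.len_eq, List.getElem?_append_right (by omega), Nat.add_sub_cancel, hy]

end Anf
end LambdaBox

-- Joining the arguments of a box

namespace LambdaBox

open Term (liftRen)

namespace Anf

variable {P K : Type*}

open Kind

/-- The substitution for a concatenation of argument lists, where the first one has length `n` and
reduces to length `m`. -/
def appSub (n m : ℕ) (s θ : ℕ → Anf P K) (x : ℕ) : Anf P K :=
  if x < n then s x else (θ (x - n)).ren (· + m)

theorem appSub_up (n m : ℕ) (s θ : ℕ → Anf P K) :
    appSub (n + 1) (m + 1) (up s) θ = up (appSub n m s θ) := by
  funext x; cases x with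
  | zero => simp [appSub]
  | succ x =>
    simp only [appSub, up_succ, Nat.add_lt_add_iff_right, Nat.add_sub_add_right]
    split
    · rfl
    · rw [ren_ren]; rfl

/-- A flattened head argument counts once in the source but `l` times in the target; a kept one, as
in `appSub_up`, counts once in both. -/
theorem appSub_scons (n m l : ℕ) (U : Anf P K) (s θ : ℕ → Anf P K) :
    appSub (n + 1) (l + m) (scons U fun x => (s x).ren (· + l)) θ =
      scons U fun x => (appSub n m s θ x).ren (· + l) := by
  funext x; cases x with
  | zero => simp [appSub]
  | succ x =>
    simp only [appSub, scons_succ, Nat.add_lt_add_iff_right, Nat.add_sub_add_right]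
    split
    · rfl
    · rw [ren_ren]; congr 1; funext y; simp; omega

theorem ren_add_subst_appSub (n m : ℕ) (s θ : ℕ → Anf P K) (t : Anf P K) :
    (t.ren (· + n)).subst (appSub n m s θ) = (t.subst θ).ren (· + m) := by
  rw [subst_ren, ren_subst]; congr 1; funext x; simp [appSub]

/-- Needed because flattening produces concatenations, which must be reducible further, each part
with its own substitution. -/
theorem Par.append {ns ns' as as' : Anf P K} {s θ : ℕ → Anf P K} (hn : Spine ns) (ha : Pure as)
    (h : Par ns ns' s) (h' : Par as as' θ) :
    Par (append ns as) (append ns' as') (appSub (len ns) (len ns') s θ) := by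
  induction ns generalizing ns' s with
  | nil =>
    cases h
    have : appSub 0 0 Anf.var θ = θ := by
      funext x; simp only [appSub, Nat.not_lt_zero, if_false]; exact ren_id _
    simp only [len, this]
    exact h'
  | cons σ V as _ ih =>
    cases h with
    | keep _ hV h =>
      simp only [len, appSub_up]
      exact .keep σ hV (ih hn h)
    | flat _ hV h hs _ =>
      rw [hs.append_assoc, hs.len_append, len, appSub_scons]
      exact .flat σ hV (ih hn h) hs ha.append
  | _ => exact hn.elim

/-- Any two parallel reducts have a common parallel reduct. -/
def Joinable (t : Anf P K) : Prop :=
  ∀ ⦃t₁ t₂⦄, Par t t₁ var → Par t t₂ var → ∃ t₃, Par t₁ t₃ var ∧ Par t₂ t₃ var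

/-- An argument `X` of type `□σ` contributes the arguments `ns` to its box and the substitute `U`
to the body of the box. -/
def Contributes (σ : Ty P) (X ns U : Anf P K) : Prop :=
  ns = cons σ X nil ∧ U = var 0 ∨ X = box ns U ∧ Spine ns

/-- Parallel reduction of contributions. -/
def ParPair (ns U ns' U' : Anf P K) : Prop :=
  ∃ s U'', Par ns ns' s ∧ Par U U'' var ∧ U''.subst s = U'

theorem Par.cons_inv {σ : Ty P} {V as t : Anf P K} {θ : ℕ → Anf P K} (h : Par (cons σ V as) t θ) :
    ∃ X ns U as' θ', Par V X Anf.var ∧ Par as as' θ' ∧ Contributes σ X ns U ∧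
      t = Anf.append ns as' ∧ θ = Anf.scons U fun x => (θ' x).ren (· + len ns) := by
  cases h with
  | keep _ hV h => exact ⟨_, _, _, _, _, hV, h, .inl ⟨rfl, rfl⟩, rfl, rfl⟩
  | flat _ hV h hs _ => exact ⟨_, _, _, _, _, hV, h, .inr ⟨rfl, hs⟩, rfl, rfl⟩

variable {tc : K → Ty P} {Γ : List (Ty P)}

theorem Contributes.hasT {σ : Ty P} {X ns U : Anf P K} (h : Contributes σ X ns U)
    (hX : HasT tc Γ X (val (.nec σ))) :
    ∃ τs, HasT tc Γ ns (args τs) ∧ HasT tc τs U (val σ) := by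
  obtain ⟨rfl, rfl⟩ | ⟨rfl, _⟩ := h
  · exact ⟨_, .cons hX (.nil _), .var rfl⟩
  · cases hX with
    | box hn hU => exact ⟨_, hn, hU⟩

theorem ParPair.keep {V V' : Anf P K} (σ : Ty P) (h : Par V V' var) :
    ParPair (cons σ V nil) (var 0) (cons σ V' nil) (var 0) :=
  ⟨_, _, .keep σ h .nil, .refl _, rfl⟩

theorem ParPair.flat {V ns U : Anf P K} (σ : Ty P) (h : Par V (box ns U) var) (hn : Spine ns) :
    ParPair (cons σ V nil) (var 0) ns U :=
  ⟨_, _, by simpa only [hn.append_nil] using Par.flat σ h .nil hn trivial, .refl _, rfl⟩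

/-- A contribution reduced further either remains one unflattened argument or becomes the contents
of a box. In the `idBox` case the contracted box is `box x = Z in x`; typing makes its annotation
equal to `σ`, so its contents are exactly what `Z` contributes when it is kept. -/
theorem Contributes.par {σ : Ty P} {X Y ns U : Anf P K} (h : Contributes σ X ns U)
    (hX : HasT tc Γ X (val (.nec σ))) (hXY : Par X Y var) :
    (∃ Z, ns = cons σ Z nil ∧ U = var 0 ∧ Par Z Y var) ∨
      ∃ ns' U', Y = box ns' U' ∧ Spine ns' ∧ ParPair ns U ns' U' := by
  obtain ⟨rfl, rfl⟩ | ⟨rfl, _⟩ := h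
  · exact .inl ⟨X, rfl, rfl, hXY⟩
  · have hY : HasT tc Γ Y (val (.nec σ)) := hX.reduct hXY
    cases hXY with
    | box ha hM =>
      cases hY with
      | box hn _ => exact .inr ⟨_, _, rfl, hn.spine, _, _, ha, hM, rfl⟩
    | idBox _ _ h =>
      cases hX with
      | box hn hU =>
      cases hn with
      | cons _ hn =>
      cases hn with
      | nil =>
      cases hU with
      | var e => cases e; exact .inl ⟨_, rfl, rfl, h⟩

/-- Both reducts of `V` meet at some `Y`. If only one side still has an unflattened argument, the
other shows that `Y` is a box, and the unflattened argument can be flattened now. -/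
theorem Contributes.join {σ : Ty P} {V X₁ X₂ ns₁ ns₂ U₁ U₂ : Anf P K} (hV : Joinable V)
    (ht : HasT tc Γ V (val (.nec σ))) (hX₁ : Par V X₁ var) (hX₂ : Par V X₂ var)
    (h₁ : Contributes σ X₁ ns₁ U₁) (h₂ : Contributes σ X₂ ns₂ U₂) :
    ∃ ns U, ParPair ns₁ U₁ ns U ∧ ParPair ns₂ U₂ ns U := by
  obtain ⟨Y, hY₁, hY₂⟩ := hV hX₁ hX₂
  obtain ⟨Z₁, rfl, rfl, hZ₁⟩ | ⟨ns, U, rfl, hs, hp₁⟩ := h₁.par (ht.reduct hX₁) hY₁ <;>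
  obtain ⟨Z₂, rfl, rfl, hZ₂⟩ | ⟨ns', U', e, hs', hp₂⟩ := h₂.par (ht.reduct hX₂) hY₂
  · exact ⟨_, _, .keep σ hZ₁, .keep σ hZ₂⟩
  · subst e
    exact ⟨_, _, .flat σ hZ₁ hs', hp₂⟩
  · exact ⟨_, _, hp₁, .flat σ hZ₂ hs⟩
  · cases e
    exact ⟨_, _, hp₁, hp₂⟩

/-- The number of nodes. -/
def size : Anf P K → ℕ
  | lam _ N => size N + 1
  | call V W N => size V + size W + size N + 1
  | box as M => size as + size M + 1
  | cons _ V as => size V + size as + 1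
  | _ => 1

theorem size_ren (f : ℕ → ℕ) (t : Anf P K) : size (t.ren f) = size t := by
  induction t generalizing f <;> simp_all [size, ren]

theorem HasT.pure_of_par {as as' : Anf P K} {σs : List (Ty P)} {θ : ℕ → Anf P K}
    (ht : HasT tc Γ as (args σs)) (h : Par as as' θ) (x : ℕ) : Pure (θ x) := by
  induction as generalizing σs as' θ x with
  | nil => cases h; trivial
  | cons σ V as _ ih =>
    cases ht with
    | cons hV hat =>
    obtain ⟨X, ns, U, as'', θ', hX, ha, hc, -, rfl⟩ := h.cons_inv
    obtain ⟨τs, -, hU⟩ := hc.hasT (hV.reduct hX)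
    exact Pure.scons hU.pure (fun x => (ih hat ha x).ren _) x
  | _ => cases ht

/-- The two reducts may have flattened different arguments and so bind different variables. For a
box body it is enough that the argument lists meet, that the substitutes reduce, and that
substituting in two stages gives the same result on both sides; the arguments can be treated one at
a time. -/
theorem join_args {as as₁ as₂ : Anf P K} {σs : List (Ty P)} {θ₁ θ₂ : ℕ → Anf P K}
    (hj : ∀ V τ, size V < size as → HasT tc Γ V (val τ) → Joinable V)
    (ht : HasT tc Γ as (args σs)) (h₁ : Par as as₁ θ₁) (h₂ : Par as as₂ θ₂) :
    ∃ (as₃ : Anf P K) (s₁ s₂ η₁ η₂ : ℕ → Anf P K),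
      Par as₁ as₃ s₁ ∧ Par as₂ as₃ s₂ ∧ (∀ x, Par (θ₁ x) (η₁ x) var) ∧
      (∀ x, Par (θ₂ x) (η₂ x) var) ∧
      ∀ x < σs.length, (η₁ x).subst s₁ = (η₂ x).subst s₂ := by
  induction as generalizing σs as₁ as₂ θ₁ θ₂ with
  | nil =>
    cases h₁; cases h₂
    exact ⟨_, _, _, _, _, .nil, .nil, fun _ => .refl _, fun _ => .refl _, fun _ _ => rfl⟩
  | cons σ V as _ ih =>
    cases ht with
    | cons hV hat =>
    have hVj := hj V _ (by simp only [size]; omega) hV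
    have hj' : ∀ V τ, size V < size as → HasT tc Γ V (val τ) → Joinable V := fun V τ h =>
      hj V τ (by simp only [size]; omega)
    obtain ⟨X₁, ns₁, U₁, as₁, θ₁, hX₁, ha₁, hc₁, rfl, rfl⟩ := h₁.cons_inv
    obtain ⟨X₂, ns₂, U₂, as₂, θ₂, hX₂, ha₂, hc₂, rfl, rfl⟩ := h₂.cons_inv
    obtain ⟨as₃, s₁, s₂, η₁, η₂, hs₁, hs₂, hη₁, hη₂, e⟩ := ih hj' hat ha₁ ha₂
    obtain ⟨ns, U, ⟨r₁, U₁', hr₁, hU₁, rfl⟩, ⟨r₂, U₂', hr₂, hU₂, eU⟩⟩ :=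
      Contributes.join hVj hV hX₁ hX₂ hc₁ hc₂
    obtain ⟨τs₁, hn₁, hUt₁⟩ := hc₁.hasT (hV.reduct hX₁)
    obtain ⟨τs₂, hn₂, hUt₂⟩ := hc₂.hasT (hV.reduct hX₂)
    obtain ⟨_, hat₁, -⟩ := hat.reduct ha₁
    obtain ⟨_, hat₂, -⟩ := hat.reduct ha₂
    -- `U` lives in the scope of the contribution of the head argument, where `appSub` is just its
    -- first component.
    have key {U : Anf P K} {τs : List (Ty P)} {n m : ℕ} {s θ : ℕ → Anf P K}
        (h : HasT tc τs U (val σ)) (hn : n = τs.length) :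
        U.subst (appSub n m s θ) = U.subst s :=
      h.subst_congr fun x hx => by simp [appSub, hn, hx]
    refine ⟨_, _, _, scons U₁' fun x => (η₁ x).ren (· + len ns₁),
      scons U₂' fun x => (η₂ x).ren (· + len ns₂), hr₁.append hn₁.spine hat₁.spine.pure hs₁,
      hr₂.append hn₂.spine hat₂.spine.pure hs₂, Par.scons hU₁ fun x => (hη₁ x).ren _,
      Par.scons hU₂ fun x => (hη₂ x).ren _, fun x hx => ?_⟩
    cases x with
    | zero =>
      rw [scons_zero, scons_zero, key (hUt₁.reduct hU₁) hn₁.len_eq,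
        key (hUt₂.reduct hU₂) hn₂.len_eq, eU]
    | succ x =>
      simp only [scons_succ, ren_add_subst_appSub]
      rw [e x (by simpa using hx)]
  | _ => cases ht

-- The diamond property

theorem ren_liftRen_succ_subst (t : Anf P K) :
    (t.ren (liftRen Nat.succ)).subst (scons (var 0) var) = t := by
  rw [subst_ren]
  convert subst_var t using 2
  funext x; cases x <;> rfl

/-- Contracting a call of an η-expansion only undoes the expansion. This resolves every overlap of β
with η in the function position of a call. -/
theorem bind_subst_eta (V W N : Anf P K) :
    bind ((call (V.ren Nat.succ) (var 0) (var 0)).subst (scons W var)) N = call V W N := by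
  simp only [subst, ren_succ_subst_scons, bind_call, scons_zero, up_zero, subst_var]
  rw [bind_pure (by trivial), ren_liftRen_succ_subst]

theorem Par.lam_inv {σ : Ty P} {N t : Anf P K} (h : Par (Anf.lam σ N) t Anf.var) :
    (∃ N', Par N N' Anf.var ∧ t = Anf.lam σ N') ∨
      ∃ V, Pure V ∧ N = Anf.call (V.ren Nat.succ) (Anf.var 0) (Anf.var 0) ∧ Par V t Anf.var := by
  cases h with
  | lam _ h => exact .inl ⟨_, h, rfl⟩
  | eta _ hp h => exact .inr ⟨_, hp, rfl, h⟩

theorem Par.subst_single {Q Q' W W' : Anf P K} (hp : Pure W) (hQ : Par Q Q' Anf.var)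
    (hW : Par W W' Anf.var) :
    Par (Q.subst (Anf.scons W Anf.var)) (Q'.subst (Anf.scons W' Anf.var)) Anf.var :=
  hQ.subst (Pure.scons hp fun _ => by trivial) (Par.scons hW fun _ => .refl _)

/-- If the call under the abstraction is kept, η still applies after strengthening the reduct of
`V`. If it is contracted, `V` has reduced to an abstraction `X`, and the left side is `X` itself up
to its annotation. -/
theorem join_lam_eta {σ τ : Ty P} {V V₂ N₁ : Anf P K} (hV : Joinable V)
    (ht : HasT tc Γ V (val (.imp σ τ)))
    (h₁ : Par (call (V.ren Nat.succ) (var 0) (var 0)) N₁ var) (h₂ : Par V V₂ var) :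
    ∃ t, Par (lam σ N₁) t var ∧ Par V₂ t var := by
  cases h₁ with
  | call hV₁ hW hN =>
    cases hW; cases hN
    obtain ⟨X, rfl, hX⟩ := hV₁.of_ren_succ
    obtain ⟨V₃, h₁₃, h₂₃⟩ := hV hX h₂
    exact ⟨V₃, .eta σ (hX.pure ht.pure) h₁₃, h₂₃⟩
  | beta hV₁ hW hN =>
    cases hW; cases hN
    obtain ⟨X, e, hX⟩ := hV₁.of_ren_succ
    have htX : HasT tc Γ X (val (.imp σ τ)) := ht.reduct hX
    obtain ⟨t, h₁, h₂⟩ := hV hX h₂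
    cases X <;> simp only [ren, reduceCtorEq] at e
    cases e
    -- The type of `X` identifies its annotation with `σ`.
    cases htX
    refine ⟨t, ?_, h₂⟩
    rwa [bind_var_zero, ren_liftRen_succ_subst]

/-- The reducts of `V` meet at `V₃`. If `V₃` comes from reducing under the abstraction, the
remaining call is contracted. If it comes from η, then the contractum is again a call by
`bind_subst_eta`, and congruence suffices. -/
theorem join_call_beta {σ : Ty P} {V V₁ W W₁ W₂ N N₁ N₂ Q : Anf P K} (hV : Joinable V)
    (hW : Joinable W) (hN : Joinable N) (hp : Pure W) (hV₁ : Par V V₁ var) (hW₁ : Par W W₁ var)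
    (hN₁ : Par N N₁ var) (hV₂ : Par V (lam σ Q) var) (hW₂ : Par W W₂ var) (hN₂ : Par N N₂ var) :
    ∃ t, Par (call V₁ W₁ N₁) t var ∧ Par (bind (Q.subst (scons W₂ var)) N₂) t var := by
  obtain ⟨V₃, hV₁₃, hV₂₃⟩ := hV hV₁ hV₂
  obtain ⟨W₃, hW₁₃, hW₂₃⟩ := hW hW₁ hW₂
  obtain ⟨N₃, hN₁₃, hN₂₃⟩ := hN hN₁ hN₂
  obtain ⟨Q', hQ, rfl⟩ | ⟨X, -, rfl, h⟩ := hV₂₃.lam_inv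
  · exact ⟨_, .beta hV₁₃ hW₁₃ hN₁₃ (hW₁.pure hp), (hQ.subst_single (hW₂.pure hp) hW₂₃).bind hN₂₃⟩
  · exact ⟨_, .call hV₁₃ hW₁₃ hN₁₃, bind_subst_eta X W₂ N₂ ▸ .call h hW₂₃ hN₂₃⟩

theorem join_beta_beta {σ₁ σ₂ : Ty P} {V W W₁ W₂ N N₁ N₂ Q₁ Q₂ : Anf P K} (hV : Joinable V)
    (hW : Joinable W) (hN : Joinable N) (hp : Pure W) (hV₁ : Par V (lam σ₁ Q₁) var)
    (hW₁ : Par W W₁ var) (hN₁ : Par N N₁ var) (hV₂ : Par V (lam σ₂ Q₂) var) (hW₂ : Par W W₂ var)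
    (hN₂ : Par N N₂ var) :
    ∃ t, Par (bind (Q₁.subst (scons W₁ var)) N₁) t var ∧
      Par (bind (Q₂.subst (scons W₂ var)) N₂) t var := by
  obtain ⟨V₃, hV₁₃, hV₂₃⟩ := hV hV₁ hV₂
  obtain ⟨W₃, hW₁₃, hW₂₃⟩ := hW hW₁ hW₂
  obtain ⟨N₃, hN₁₃, hN₂₃⟩ := hN hN₁ hN₂
  have hp₁ := hW₁.pure hp
  have hp₂ := hW₂.pure hp
  obtain ⟨Q, hQ₁, rfl⟩ | ⟨X₁, -, rfl, h₁⟩ := hV₁₃.lam_inv <;>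
  obtain ⟨Q', hQ₂, e⟩ | ⟨X₂, -, rfl, h₂⟩ := hV₂₃.lam_inv
  · cases e
    exact ⟨_, (hQ₁.subst_single hp₁ hW₁₃).bind hN₁₃, (hQ₂.subst_single hp₂ hW₂₃).bind hN₂₃⟩
  · exact ⟨_, (hQ₁.subst_single hp₁ hW₁₃).bind hN₁₃,
      bind_subst_eta X₂ W₂ N₂ ▸ .beta h₂ hW₂₃ hN₂₃ hp₂⟩
  · subst e
    exact ⟨_, bind_subst_eta X₁ W₁ N₁ ▸ .beta h₁ hW₁₃ hN₁₃ hp₁,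
      (hQ₂.subst_single hp₂ hW₂₃).bind hN₂₃⟩
  · rw [bind_subst_eta, bind_subst_eta]
    exact ⟨_, .call h₁ hW₁₃ hN₁₃, .call h₂ hW₂₃ hN₂₃⟩

/-- If the only argument `X` is kept, `idBox` still applies; if it is flattened, the outer box has
already become `X`. -/
theorem join_box_idBox {σ τ : Ty P} {V V₂ t₁ : Anf P K} {θ : ℕ → Anf P K} (hV : Joinable V)
    (ht : HasT tc Γ V (val (.nec τ)))
    (h₁ : Par (cons σ V nil) t₁ θ) (h₂ : Par V V₂ var) :
    ∃ t, Par (box t₁ ((var 0).subst θ)) t var ∧ Par V₂ t var := by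
  obtain ⟨X, ns, U, as', θ', hX, ha, ⟨rfl, rfl⟩ | ⟨rfl, hn⟩, rfl, rfl⟩ := h₁.cons_inv <;>
  obtain ⟨t, h, h'⟩ := hV hX h₂ <;> cases ha
  · exact ⟨t, .idBox σ (hX.pure ht.pure) h, h'⟩
  · refine ⟨t, ?_, h'⟩
    rwa [hn.append_nil]

/-- The induction is on size rather than on structure because η uses the joinability of a function
whose weakening, not the function itself, is a subterm. -/
theorem joinable_of_hasT (n : ℕ) {t : Anf P K} {τ : Ty P} (hn : size t < n)
    (ht : HasT tc Γ t (comp τ)) : Joinable t := by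
  induction n generalizing t Γ τ with
  | zero => omega
  | succ n ih =>
    intro t₁ t₂ h₁ h₂
    cases ht with
    | call hV hW hN => 
      simp only [size] at hn
      replace hp := hW.pure
      replace hV := ih (by omega) hV.ret
      replace hW := ih (by omega) hW.ret
      replace hN := ih (by omega) hN
      cases h₁ with
      | call hV₁ hW₁ hN₁ =>
        cases h₂ with
        | call hV₂ hW₂ hN₂ =>
          obtain ⟨V₃, hV₁₃, hV₂₃⟩ := hV hV₁ hV₂
          obtain ⟨W₃, hW₁₃, hW₂₃⟩ := hW hW₁ hW₂
          obtain ⟨N₃, hN₁₃, hN₂₃⟩ := hN hN₁ hN₂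
          exact ⟨_, .call hV₁₃ hW₁₃ hN₁₃, .call hV₂₃ hW₂₃ hN₂₃⟩
        | beta hV₂ hW₂ hN₂ => exact join_call_beta hV hW hN hp hV₁ hW₁ hN₁ hV₂ hW₂ hN₂
      | beta hV₁ hW₁ hN₁ =>
        cases h₂ with
        | call hV₂ hW₂ hN₂ =>
          obtain ⟨t, h, h'⟩ := join_call_beta hV hW hN hp hV₂ hW₂ hN₂ hV₁ hW₁ hN₁
          exact ⟨t, h', h⟩
        | beta hV₂ hW₂ hN₂ => exact join_beta_beta hV hW hN hp hV₁ hW₁ hN₁ hV₂ hW₂ hN₂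
    | ret ht =>
      cases ht with
      | const => cases h₁; cases h₂; exact ⟨_, .refl _, .refl _⟩
      | var => cases h₁; cases h₂; exact ⟨_, .refl _, .refl _⟩
      | lam hN =>
        simp only [size] at hn
        have aux {σ τ : Ty P} {V : Anf P K} (ht : HasT tc (σ :: Γ)
            (call (V.ren Nat.succ) (var 0) (var 0)) (comp τ))
            (hn : size (call (V.ren Nat.succ) (var 0) (var 0)) + 1 < n + 1) :
            HasT tc Γ V (val (.imp σ τ)) ∧ Joinable V := by
          have hV := ht.eta_inv
          simp only [size, size_ren] at hn
          exact ⟨hV, ih (by omega) hV.ret⟩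
        obtain ⟨N₁, k₁, rfl⟩ | ⟨V₁, -, rfl, k₁⟩ := h₁.lam_inv <;>
        obtain ⟨N₂, k₂, rfl⟩ | ⟨V₂, -, e, k₂⟩ := h₂.lam_inv
        · obtain ⟨N₃, h₁₃, h₂₃⟩ := ih (by omega) hN k₁ k₂
          exact ⟨_, .lam _ h₁₃, .lam _ h₂₃⟩
        · subst e
          obtain ⟨ht, hV⟩ := aux hN hn
          exact join_lam_eta hV ht k₁ k₂
        · obtain ⟨ht, hV⟩ := aux hN hn
          obtain ⟨t, h, h'⟩ := join_lam_eta hV ht k₂ k₁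
          exact ⟨t, h', h⟩
        · obtain ⟨ht, hV⟩ := aux hN hn
          cases ren_succ_injective (call.inj e).1
          exact hV k₁ k₂
      | box ha hM =>
        simp only [size] at hn
        have aux {σ : Ty P} {σs : List (Ty P)} {V : Anf P K}
            (ha : HasT tc Γ (cons σ V nil) (args σs)) (hn : size (cons σ V nil) < n) :
            HasT tc Γ V (val (.nec σ)) ∧ Joinable V := by
          cases ha with
          | cons hV _ =>
          simp only [size] at hn
          exact ⟨hV, ih (by omega) hV.ret⟩
        cases h₁ with
        | box ha₁ hM₁ =>
          cases h₂ with
          | box ha₂ hM₂ =>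
            obtain ⟨M₃, hM₁₃, hM₂₃⟩ := ih (by omega) hM.ret hM₁ hM₂
            obtain ⟨as₃, s₁, s₂, η₁, η₂, hs₁, hs₂, hη₁, hη₂, e⟩ :=
              join_args (fun V τ h hV => ih (by omega) hV.ret) ha ha₁ ha₂
            -- `M₃` is typed in the scope of the box, so it suffices that the two composite
            -- substitutions agree on that scope.
            have hM₃ : HasT tc _ M₃ (val _) := HasT.reduct (hM.reduct hM₁) hM₁₃
            refine ⟨_, .box hs₁ (hM₁₃.subst (ha.pure_of_par ha₁) hη₁), ?_⟩
            convert Par.box hs₂ (hM₂₃.subst (ha.pure_of_par ha₂) hη₂) using 2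
            rw [subst_subst, subst_subst]
            exact hM₃.subst_congr e
          | idBox _ _ h₂ =>
            cases hM₁
            obtain ⟨ht, hV⟩ := aux ha (by omega)
            exact join_box_idBox hV ht ha₁ h₂
        | idBox _ _ h₁ =>
          obtain ⟨ht, hV⟩ := aux ha (by omega)
          cases h₂ with
          | box ha₂ hM₂ =>
            cases hM₂
            obtain ⟨t, h, h'⟩ := join_box_idBox hV ht ha₂ h₁
            exact ⟨t, h', h⟩
          | idBox _ _ h₂ => exact hV h₁ h₂

theorem reduct_of_reflTransGen {t t' : Anf P K} {τ : Ty P} (ht : HasT tc Γ t (comp τ))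
    (h : Relation.ReflTransGen (Par · · var) t t') : HasT tc Γ t' (comp τ) := by
  induction h with
  | refl => exact ht
  | tail _ h ih => exact ih.reduct h

/-- Confluence of parallel reduction on typed terms. -/
theorem confluence {t t₁ t₂ : Anf P K} {τ : Ty P} (ht : HasT tc Γ t (comp τ))
    (h₁ : Relation.ReflTransGen (Par · · var) t t₁)
    (h₂ : Relation.ReflTransGen (Par · · var) t t₂) :
    Relation.Join (Relation.ReflTransGen (Par · · var)) t₁ t₂ := by
  -- Building typedness into the relation makes the diamond property hold without further
  -- conditions; subject reduction passes between `r` and `Par`.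
  let r : Anf P K → Anf P K → Prop := fun s s' => HasT tc Γ s (comp τ) ∧ Par s s' var
  have typed {s : Anf P K} (h : Relation.ReflTransGen (Par · · var) t s) :
      Relation.ReflTransGen r t s := by
    induction h with
    | refl => exact .refl
    | tail h h' ih => exact ih.tail ⟨reduct_of_reflTransGen ht h, h'⟩
  have untyped {s s' : Anf P K} (h : Relation.ReflTransGen r s s') :
      Relation.ReflTransGen (Par · · var) s s' :=
    Relation.ReflTransGen.mono (fun _ _ h => h.2) _ _ h
  obtain ⟨t₃, h₁₃, h₂₃⟩ := Relation.church_rosser (r := r) (fun a b c hb hc => by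
    obtain ⟨d, hbd, hcd⟩ := joinable_of_hasT _ (Nat.lt_succ_self _) hb.1 hb.2 hc.2
    exact ⟨d, .single ⟨hb.1.reduct hb.2, hbd⟩, .single ⟨hc.1.reduct hc.2, hcd⟩⟩)
    (typed h₁) (typed h₂)
  exact ⟨t₃, untyped h₁₃, untyped h₂₃⟩

end Anf
end LambdaBox

-- Applications and boxes of computations

namespace LambdaBox

open Term (liftRen)

namespace Anf

variable {P K : Type*}

/-- The argument list with the given types and entries. -/
def mkArgs : List (Ty P) → List (Anf P K) → Anf P K
  | σ :: σs, V :: Vs => cons σ V (mkArgs σs Vs)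
  | _, _ => nil

/-- Sequencing of a list: the terms are run from left to right, and the continuation `k` receives
the results, appended to `acc`, and the weakening from the scope of the terms to that of the
results. The terms are renamed by `f` before. -/
def seqK (k : (ℕ → ℕ) → List (Anf P K) → Anf P K) :
    List (Anf P K) → (ℕ → ℕ) → List (Anf P K) → Anf P K
  | [], f, acc => k f acc
  | t :: ts, f, acc => bindK (t.ren f) fun g v => seqK k ts (g ∘ f) (acc.map (ren g) ++ [v])

/-- Application of the result of `m` to the result of `n`. -/
def appNf (m n : Anf P K) : Anf P K :=
  bind m (bind (n.ren Nat.succ) (call (var 1) (var 0) (var 0)))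

/-- The box whose arguments are the results of `ts`. -/
def boxNf (σs : List (Ty P)) (ts : List (Anf P K)) (M : Anf P K) : Anf P K :=
  seqK (fun _ vs => box (mkArgs σs vs) M) ts id []

theorem subst_mkArgs (s : ℕ → Anf P K) (σs : List (Ty P)) (vs : List (Anf P K)) :
    (mkArgs σs vs).subst s = mkArgs σs (vs.map (subst s)) := by
  induction σs generalizing vs with
  | nil => rfl
  | cons σ σs ih => cases vs <;> simp [mkArgs, subst, ih]

theorem ren_mkArgs (f : ℕ → ℕ) (σs : List (Ty P)) (vs : List (Anf P K)) :
    (mkArgs σs vs).ren f = mkArgs σs (vs.map (ren f)) := by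
  induction σs generalizing vs with
  | nil => rfl
  | cons σ σs ih => cases vs <;> simp [mkArgs, ren, ih]

theorem spine_mkArgs (σs : List (Ty P)) (vs : List (Anf P K)) : Spine (mkArgs σs vs) := by
  induction σs generalizing vs with
  | nil => trivial
  | cons σ σs ih =>
    cases vs
    · trivial
    · exact ih _

theorem len_mkArgs {σs : List (Ty P)} {vs : List (Anf P K)} (h : σs.length = vs.length) :
    len (mkArgs σs vs) = vs.length := by
  induction σs generalizing vs with
  | nil => cases vs <;> simp_all [mkArgs, len]
  | cons σ σs ih => cases vs <;> simp_all [mkArgs, len]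

theorem mkArgs_append {σs : List (Ty P)} {vs : List (Anf P K)} (h : σs.length = vs.length)
    (τs : List (Ty P)) (ws : List (Anf P K)) :
    mkArgs (σs ++ τs) (vs ++ ws) = append (mkArgs σs vs) (mkArgs τs ws) := by
  induction σs generalizing vs with
  | nil => cases vs <;> simp_all [mkArgs, append]
  | cons σ σs ih => cases vs <;> simp_all [mkArgs, append]

theorem subst_seqK {k k' : (ℕ → ℕ) → List (Anf P K) → Anf P K} {s : ℕ → Anf P K}
    (hk : ∀ g g' h, (∀ x, Pure (h x)) → (∀ x, h (g x) = (s x).ren g') → ∀ vs,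
      (k g vs).subst h = k' g' (vs.map (subst h))) (ts : List (Anf P K)) {f f' : ℕ → ℕ}
    {h : ℕ → Anf P K} (hp : ∀ x, Pure (h x)) (hf : ∀ x, h (f x) = (s x).ren f')
    (acc : List (Anf P K)) :
    (seqK k ts f acc).subst h = seqK k' (ts.map (subst s)) f' (acc.map (subst h)) := by
  induction ts generalizing f f' h acc with
  | nil => exact hk _ _ _ hp hf _
  | cons t ts ih =>
    simp only [seqK, List.map_cons]
    have e : (t.subst s).ren f' = (t.ren f).subst h := by
      rw [ren_subst, subst_ren]; simp only [hf]
    rw [e]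
    refine subst_bindK hp fun g g' j hj hg v hv => ?_
    rw [ih (f' := g' ∘ f') hj (fun x => by simp only [Function.comp, hg, hf, ren_ren])]
    simp only [List.map_append, List.map_map, List.map_cons, List.map_nil]
    congr 2
    refine List.map_congr_left fun a _ => ?_
    simp only [Function.comp, subst_ren, ren_subst, hg]

theorem subst_boxNf (σs : List (Ty P)) (ts : List (Anf P K)) (M : Anf P K) {s : ℕ → Anf P K}
    (hs : ∀ x, Pure (s x)) : (boxNf σs ts M).subst s = boxNf σs (ts.map (subst s)) M := by
  refine subst_seqK (fun g g' h _ _ vs => ?_) ts hs (fun x => by simp) []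
  rw [subst, subst_mkArgs]

theorem subst_appNf (m n : Anf P K) {s : ℕ → Anf P K}
    (hs : ∀ x, Pure (s x)) : (appNf m n).subst s = appNf (m.subst s) (n.subst s) := by
  rw [appNf, subst_bind _ _ hs, subst_bind _ _ (Pure.up hs), ren_succ_subst_up]
  rfl

theorem pure_var_comp (f : ℕ → ℕ) (x : ℕ) : Pure (var (f x) : Anf P K) := trivial

theorem ren_boxNf (σs : List (Ty P)) (ts : List (Anf P K)) (M : Anf P K) (f : ℕ → ℕ) :
    (boxNf σs ts M).ren f = boxNf σs (ts.map (ren f)) M := by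
  rw [ren_eq_subst, subst_boxNf _ _ _ (pure_var_comp f)]
  congr 1; exact List.map_congr_left fun _ _ => (ren_eq_subst _ _).symm

theorem ren_appNf (m n : Anf P K) (f : ℕ → ℕ) :
    (appNf m n).ren f = appNf (m.ren f) (n.ren f) := by
  simp only [ren_eq_subst f, subst_appNf _ _ (pure_var_comp f)]

theorem seqK_append (k : (ℕ → ℕ) → List (Anf P K) → Anf P K) (ts us : List (Anf P K))
    (f : ℕ → ℕ) (acc : List (Anf P K)) :
    seqK k (ts ++ us) f acc = seqK (fun g vs => seqK k us g vs) ts f acc := by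
  induction ts generalizing f acc with
  | nil => rfl
  | cons t ts ih => simp only [List.cons_append, seqK, ih]

theorem seqK_pure (k : (ℕ → ℕ) → List (Anf P K) → Anf P K) {vs : List (Anf P K)}
    (h : ∀ v ∈ vs, Pure v) (f : ℕ → ℕ) (acc : List (Anf P K)) :
    seqK k vs f acc = k f (acc ++ vs.map (ren f)) := by
  induction vs generalizing f acc with
  | nil => simp [seqK]
  | cons v vs ih =>
    rw [seqK, bindK_pure ((h v (by simp)).ren f), ih (fun w hw => h w (by simp [hw]))]
    have e : (acc.map (ren id)) = acc := by simp [funext ren_id]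
    rw [e]; simp

theorem map_ren_id (ts : List (Anf P K)) : ts.map (ren id) = ts := by
  simp [funext ren_id]

theorem seqK_congr {R : Anf P K → Anf P K → Prop}
    (hR : ∀ V W N N', R N N' → R (call V W N) (call V W N')) {ts : List (Anf P K)}
    {k k' : (ℕ → ℕ) → List (Anf P K) → Anf P K} {f : ℕ → ℕ} {acc acc' : List (Anf P K)}
    (h : ∀ r vs, vs.length = ts.length →
      R (k (r ∘ f) (acc.map (ren r) ++ vs)) (k' (r ∘ f) (acc'.map (ren r) ++ vs))) :
    R (seqK k ts f acc) (seqK k' ts f acc') := by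
  induction ts generalizing f acc acc' with
  | nil => simpa [map_ren_id, seqK] using h id [] rfl
  | cons t ts ih =>
    refine bindK_congr hR fun g v _ => ih fun r vs hvs => ?_
    have := h (r ∘ g) (v.ren r :: vs) (by simp [hvs])
    simpa [ren_ren, Function.comp_def] using this

theorem bindK_seqK (k : (ℕ → ℕ) → List (Anf P K) → Anf P K)
    (k' : (ℕ → ℕ) → Anf P K → Anf P K) (ts : List (Anf P K)) (f : ℕ → ℕ)
    (acc : List (Anf P K)) :
    bindK (seqK k ts f acc) (fun h => k' (h ∘ f)) =
      seqK (fun g vs => bindK (k g vs) fun h => k' (h ∘ g)) ts f acc := by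
  induction ts generalizing f acc with
  | nil => rfl
  | cons t ts ih =>
    simp only [seqK, bindK_bindK]
    exact bindK_congr_eq fun g v _ => ih (g ∘ f) _

theorem seqK_map_ren (k : List (Anf P K) → Anf P K) (ts : List (Anf P K)) (f g : ℕ → ℕ)
    (acc : List (Anf P K)) :
    seqK (fun _ => k) (ts.map (ren f)) g acc = seqK (fun _ => k) ts (g ∘ f) acc := by
  induction ts generalizing g acc with
  | nil => rfl
  | cons t ts ih => simp only [List.map_cons, seqK, ih, ren_ren]; rfl

theorem boxNf_append_cons (σs : List (Ty P)) {vs : List (Anf P K)} (hv : ∀ v ∈ vs, Pure v)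
    (t : Anf P K) (ts : List (Anf P K)) (M : Anf P K) :
    boxNf σs (vs ++ t :: ts) M = bindK t fun g v =>
      seqK (fun _ vs => box (mkArgs σs vs) M) ts g (vs.map (ren g) ++ [v]) := by
  rw [boxNf, seqK_append, seqK_pure _ hv]
  simp [map_ren_id, seqK]

/-- Leading values run no calls, so `t` runs first whether or not its result is named. This makes
`let_` an identity for box contexts. -/
theorem boxNf_eq_bind (σs : List (Ty P)) {vs : List (Anf P K)} (hv : ∀ v ∈ vs, Pure v)
    (t : Anf P K) (ts : List (Anf P K)) (M : Anf P K) :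
    boxNf σs (vs ++ t :: ts) M =
      bind t (boxNf σs (vs.map (ren Nat.succ) ++ var 0 :: ts.map (ren Nat.succ)) M) := by
  rw [boxNf_append_cons _ hv]
  refine bindK_congr_eq fun g v hp => ?_
  rw [subst_boxNf _ _ _ (Pure.scons hp (pure_var_comp g))]
  have e : subst (scons v fun x => var (g x)) ∘ ren Nat.succ = ren g := by
    funext t; simp [ren_succ_subst_scons, ren_eq_subst g]
  simp only [List.map_append, List.map_map, List.map_cons, e]
  rw [boxNf_append_cons _ (by simpa using fun a ha => (hv a ha).ren g)]
  rw [subst, scons_zero, bindK_pure hp, seqK_map_ren, map_ren_id]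
  rfl

theorem seqK_par {k k' : (ℕ → ℕ) → List (Anf P K) → Anf P K}
    (hk : ∀ g g' h, (∀ x, Pure (h x)) → (∀ x, h (g x) = var (g' x)) → ∀ vs,
      (k' g vs).subst h = k' g' (vs.map (subst h)))
    (hkk : ∀ g vs vs', (∀ v ∈ vs, Pure v) → List.Forall₂ (Par · · var) vs vs' →
      Par (k g vs) (k' g vs') var) {ts ts' : List (Anf P K)}
    (ht : List.Forall₂ (Par · · var) ts ts') {f : ℕ → ℕ} {acc acc' : List (Anf P K)}
    (hp : ∀ v ∈ acc, Pure v) (ha : List.Forall₂ (Par · · var) acc acc') :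
    Par (seqK k ts f acc) (seqK k' ts' f acc') var := by
  induction ht generalizing f acc acc' with
  | nil => exact hkk _ _ _ hp ha
  | @cons t t' ts ts' h ht ih =>
    refine (h.ren f).bindK (fun g g' h hj hg v hv => ?_) fun g v v' hv hvv => ih ?_ ?_
    · have e : ∀ t : Anf P K, (t.ren g).subst h = t.ren g' := fun t => by
        rw [subst_ren, ren_eq_subst g']; simp only [hg]
      rw [subst_seqK (s := var) hk ts' (f' := g' ∘ f) (f := g ∘ f) hj (fun x => hg _)]
      simp [Function.comp_def, e, funext subst_var]
    · simp only [List.mem_append, List.mem_map, List.mem_singleton]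
      rintro w (⟨w, hw, rfl⟩ | rfl)
      · exact (hp w hw).ren g
      · exact hv
    · refine List.rel_append ?_ (.cons hvv .nil)
      rw [List.forall₂_map_left_iff, List.forall₂_map_right_iff]
      exact ha.imp fun _ _ h => h.ren g

theorem mkArgs_par (σs : List (Ty P)) {vs vs' : List (Anf P K)}
    (h : List.Forall₂ (Par · · var) vs vs') : Par (mkArgs σs vs) (mkArgs σs vs') var := by
  induction σs generalizing vs vs' with
  | nil => exact .nil
  | cons σ σs ih =>
    cases h with
    | nil => exact .nil
    | cons h h' =>
      have := Par.keep σ h (ih h')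
      rwa [up_var] at this

theorem Par.boxNf (σs : List (Ty P)) {ts ts' : List (Anf P K)} {M M' : Anf P K}
    (ht : List.Forall₂ (Par · · Anf.var) ts ts') (hM : Par M M' Anf.var) :
    Par (boxNf σs ts M) (boxNf σs ts' M') Anf.var := by
  refine seqK_par (fun g g' h _ _ vs => ?_) (fun g vs vs' _ h => ?_) ht (by simp) .nil
  · rw [Anf.subst, subst_mkArgs]
  · simpa using Par.box (mkArgs_par σs h) hM

theorem Par.appNf {m m' n n' : Anf P K} (hm : Par m m' Anf.var) (hn : Par n n' Anf.var) :
    Par (appNf m n) (appNf m' n') Anf.var :=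
  hm.bind ((hn.ren _).bind (.refl _))

/-- Each of the preceding arguments is kept and lifts the substitution once, hence the iterated
`up`. -/
theorem mkArgs_flat {ρs τs υs : List (Ty P)} {σ : Ty P} {ws ns ps : List (Anf P K)}
    (hρ : ρs.length = ws.length) (hτ : τs.length = ns.length) (V : Anf P K) :
    Par (mkArgs (ρs ++ σ :: υs) (ws ++ box (mkArgs τs ns) V :: ps))
      (mkArgs (ρs ++ (τs ++ υs)) (ws ++ (ns ++ ps)))
      (up^[ws.length] (scons V fun x => var (x + ns.length))) := by
  induction ρs generalizing ws with
  | nil =>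
    cases ws with
    | cons => simp at hρ
    | nil =>
      have := Par.flat σ (.refl (box (mkArgs τs ns) V)) (.refl (mkArgs υs ps)) (spine_mkArgs _ _)
        (spine_mkArgs _ _).pure
      rw [len_mkArgs hτ, ← mkArgs_append hτ] at this
      exact this
  | cons ρ ρs ih =>
    cases ws with
    | nil => simp at hρ
    | cons w ws =>
      rw [List.length_cons, Function.iterate_succ_apply']
      exact .keep ρ (.refl w) (ih (by simpa using hρ))

/-- Both sides run `ns` and then `ps`, since the inner box is a pure result once its arguments have
been run. Only the final boxes differ, and those are related by one `flat`. -/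
theorem boxNf_flat {ρs τs υs : List (Ty P)} {σ : Ty P} {ws ns ps : List (Anf P K)}
    (hρ : ρs.length = ws.length) (hτ : τs.length = ns.length) (hw : ∀ w ∈ ws, Pure w)
    (V M : Anf P K) :
    Par (boxNf (ρs ++ σ :: υs) (ws ++ boxNf τs ns V :: ps) M)
      (boxNf (ρs ++ τs ++ υs) (ws ++ ns ++ ps)
        (M.subst (up^[ws.length] (scons V fun x => var (x + ns.length))))) var := by
  have hR : ∀ V W N N' : Anf P K, Par N N' var → Par (call V W N) (call V W N') var :=
    fun V W N N' h => .call (.refl V) (.refl W) h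
  rw [boxNf_append_cons _ hw]
  conv in boxNf τs ns V => rw [boxNf]
  refine Eq.subst (motive := fun t => Par t _ var) (bindK_seqK _
    (fun g v => seqK (fun _ vs => box (mkArgs (ρs ++ σ :: υs) vs) M) ps g (ws.map (ren g) ++ [v]))
    ns id []).symm ?_
  rw [boxNf, List.append_assoc, seqK_append, seqK_append, seqK_pure _ hw, map_ren_id,
    List.nil_append]
  refine seqK_congr hR fun r vs hvs => ?_
  rw [bindK_pure (by trivial)]
  refine seqK_congr hR fun r' us _ => ?_
  have := Par.box (mkArgs_flat (ρs := ρs) (τs := τs) (υs := υs) (σ := σ)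
    (ws := (ws.map (ren r)).map (ren r')) (ns := vs.map (ren r')) (ps := us) (by simpa using hρ)
    (by simp [hτ, hvs]) V) (.refl M)
  simpa [ren, ren_mkArgs, hvs] using this

end Anf
end LambdaBox

-- Translation of terms

namespace LambdaBox

open Term (liftRen liftSub)

variable {P K : Type*}

/-- Induction on terms, with an induction hypothesis for each argument of a box. -/
@[elab_as_elim]
theorem Term.induction_mem {p : Term P K → Prop} (const : ∀ c, p (.const c)) (var : ∀ x, p (.var x))
    (lam : ∀ σ M, p M → p (.lam σ M)) (app : ∀ M N, p M → p N → p (.app M N))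
    (box : ∀ σs Ns M, (∀ N ∈ Ns, p N) → p M → p (.box σs Ns M))
    (letin : ∀ N M, p N → p M → p (.letin N M)) (M : Term P K) : p M :=
  Term.rec (motive_1 := p) (motive_2 := fun Ns => ∀ N ∈ Ns, p N) const var lam app box letin
    (by simp) (fun N Ns h hs => by simpa using ⟨h, hs⟩) M

namespace Term

/-- The representation of a term in `Anf`. -/
def nf : Term P K → Anf P K
  | const c => .const c
  | var x => .var x
  | lam σ M => .lam σ (nf M)
  | app M N => Anf.appNf (nf M) (nf N)
  | box σs Ns M => Anf.boxNf σs (nfList Ns) (nf M)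
  | letin N M => Anf.bind (nf N) (nf M)
where
  /-- The representation of each term in a list. -/
  nfList : List (Term P K) → List (Anf P K)
  | [] => []
  | N :: Ns => nf N :: nfList Ns

theorem nfList_eq_map (Ns : List (Term P K)) : nf.nfList Ns = Ns.map nf := by
  induction Ns with
  | nil => rfl
  | cons N Ns ih => simp [nf.nfList, ih]

theorem nf_box (σs : List (Ty P)) (Ns : List (Term P K)) (M : Term P K) :
    nf (box σs Ns M) = Anf.boxNf σs (Ns.map nf) (nf M) := by
  rw [nf, nfList_eq_map]

theorem nf_rename (f : ℕ → ℕ) (M : Term P K) : nf (M.rename f) = (nf M).ren f := by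
  induction M using Term.induction_mem generalizing f with
  | const | var => simp [rename, nf, Anf.ren]
  | lam σ M ih => simp [rename, nf, Anf.ren, ih]
  | app M N ihM ihN => simp [rename, nf, Anf.ren_appNf, ihM, ihN]
  | box σs Ns M ih _ =>
    rw [rename, nf_box, nf_box, Anf.ren_boxNf, renameList_eq_map, List.map_map, List.map_map]
    congr 1
    exact List.map_congr_left fun N hN => ih N hN f
  | letin N M ihN ihM => simp [rename, nf, Anf.ren_bind, ihM, ihN]

end Term

open Term

theorem Value.rename {V : Term P K} (h : Value V) (f : ℕ → ℕ) : Value (V.rename f) := by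
  induction h with
  | const c => exact .const c
  | var x => exact .var _
  | lam σ M => exact .lam _ _
  | box σs Vs M _ ih =>
    rw [Term.rename, renameList_eq_map]
    exact .box _ _ _ (by simpa using ih)

theorem Value.subst {V : Term P K} (h : Value V) {s : ℕ → Term P K} (hs : ∀ x, Value (s x)) :
    Value (V.subst s) := by
  induction h with
  | const c => exact .const c
  | var x => exact hs x
  | lam σ M => exact .lam _ _
  | box σs Vs M _ ih =>
    rw [Term.subst, substList_eq_map]
    exact .box _ _ _ (by simpa using ih)

theorem Value.liftSub {s : ℕ → Term P K} (hs : ∀ x, Value (s x)) (x : ℕ) :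
    Value (liftSub s x) := by
  cases x
  · exact .var 0
  · exact (hs _).rename _

theorem Value.single {V : Term P K} (h : Value V) (x : ℕ) : Value (single V x) := by
  cases x
  · exact h
  · exact .var _

theorem Value.mergeSub {V : Term P K} (h : Value V) (a b x : ℕ) : Value (mergeSub a b V x) := by
  unfold Term.mergeSub
  split_ifs
  · exact .var _
  · exact h.rename _
  · exact .var _

theorem Value.pure_nf {V : Term P K} (h : Value V) : (nf V).Pure := by
  induction h with
  | const | var | lam => simp [nf, Anf.Pure]
  | box σs Vs M _ ih =>
    rw [nf_box, Anf.boxNf, Anf.seqK_pure _ (by simpa using ih)]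
    trivial

theorem Term.nf_liftSub (s : ℕ → Term P K) :
    (fun x => nf (liftSub s x)) = Anf.up fun x => nf (s x) := by
  funext x; cases x
  · simp [liftSub, nf]
  · simp [liftSub, Anf.up, shift, nf_rename]

/-- Restricted to values because these have pure translations by `Value.pure_nf`, so substituting
them adds no calls. -/
theorem Term.nf_subst {s : ℕ → Term P K} (hs : ∀ x, Value (s x)) (M : Term P K) :
    nf (M.subst s) = (nf M).subst fun x => nf (s x) := by
  induction M using Term.induction_mem generalizing s with
  | const | var => simp [subst, nf, Anf.subst]
  | lam σ M ih => simp [subst, nf, Anf.subst, ih (Value.liftSub hs), nf_liftSub]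
  | app M N ihM ihN =>
    simp [subst, nf, Anf.subst_appNf _ _ fun x => (hs x).pure_nf, ihM hs, ihN hs]
  | box σs Ns M ih _ =>
    rw [subst, nf_box, nf_box, Anf.subst_boxNf _ _ _ fun x => (hs x).pure_nf, substList_eq_map,
      List.map_map, List.map_map]
    congr 1
    exact List.map_congr_left fun N hN => ih N hN hs
  | letin N M ihN ihM =>
    simp [subst, nf, Anf.subst_bind _ _ fun x => (hs x).pure_nf, ihN hs, ihM (Value.liftSub hs),
      nf_liftSub]

theorem Term.nf_inst {V : Term P K} (hV : Value V) (M : Term P K) :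
    nf (M.inst V) = (nf M).subst (Anf.scons (nf V) Anf.var) := by
  rw [inst, nf_subst hV.single]
  congr 1; funext x; cases x <;> simp [single, nf]

/-- The terms of the calculus whose boxes have as many arguments as types. -/
inductive Proper : Term P K → Prop
  | const (c : K) : Proper (const c)
  | var (x : ℕ) : Proper (var x)
  | lam (σ : Ty P) (M : Term P K) : Proper M → Proper (lam σ M)
  | app (M N : Term P K) : Proper M → Proper N → Proper (app M N)
  | box (σs : List (Ty P)) (Ns : List (Term P K)) (V : Term P K) : σs.length = Ns.length →
      (∀ N ∈ Ns, Proper N) → Value V → Proper V → Proper (box σs Ns V)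
  | letin (N M : Term P K) : Proper N → Proper M → Proper (letin N M)

/-- Typing contributes only the arities of boxes here. `Proper` needs no context and is preserved by
`Step` directly, which leaves subject reduction to be proved for `Par` alone. -/
theorem Restricted.proper {tc : K → Ty P} {Γ : List (Ty P)} {M : Term P K} {τ : Ty P}
    (h : Restricted M) (ht : HasType tc Γ M τ) : Proper M := by
  induction h generalizing Γ τ with
  | const c => exact .const c
  | var x => exact .var x
  | lam σ M _ ih => cases ht with | lam _ _ _ _ h => exact .lam _ _ (ih h)
  | app M N _ _ ihM ihN => cases ht with | app _ _ _ _ _ h h' => exact .app _ _ (ihM h) (ihN h')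
  | letin M N _ _ ihM ihN =>
    cases ht with | letin _ _ _ _ _ h h' => exact .letin _ _ (ihM h) (ihN h')
  | box σs Ns V _ hV _ ih ihV =>
    cases ht with
    | box _ _ _ _ _ h hl ha =>
      refine .box _ _ _ hl.symm (fun N hN => ?_) hV (ihV h)
      obtain ⟨i, hi, rfl⟩ := List.mem_iff_getElem.1 hN
      exact ih _ hN (ha (Ns[i], σs[i]) (by
        rw [← List.getElem_zip (h := by simp; omega)]; exact List.getElem_mem _))

theorem Proper.rename {M : Term P K} (h : Proper M) (f : ℕ → ℕ) : Proper (M.rename f) := by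
  induction h generalizing f with
  | const c => exact .const c
  | var x => exact .var _
  | lam σ M _ ih => exact .lam _ _ (ih _)
  | app M N _ _ ihM ihN => exact .app _ _ (ihM _) (ihN _)
  | letin M N _ _ ihM ihN => exact .letin _ _ (ihM _) (ihN _)
  | box σs Ns V hl _ hV hV' ih _ =>
    rw [Term.rename, renameList_eq_map]
    exact .box _ _ _ (by simpa using hl) (by simpa using fun N hN => ih N hN f) hV hV'

theorem Proper.subst {M : Term P K} (h : Proper M) {s : ℕ → Term P K} (hs : ∀ x, Proper (s x)) :
    Proper (M.subst s) := by
  have lift {s : ℕ → Term P K} (hs : ∀ x, Proper (s x)) (x : ℕ) : Proper (Term.liftSub s x) := by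
    cases x
    · exact .var 0
    · exact (hs _).rename _
  induction h generalizing s with
  | const c => exact .const c
  | var x => exact hs x
  | lam σ M _ ih => exact .lam _ _ (ih (lift hs))
  | app M N _ _ ihM ihN => exact .app _ _ (ihM hs) (ihN hs)
  | letin M N _ _ ihM ihN => exact .letin _ _ (ihM hs) (ihN (lift hs))
  | box σs Ns V hl _ hV hV' ih _ =>
    rw [Term.subst, substList_eq_map]
    exact .box _ _ _ (by simpa using hl) (by simpa using fun N hN => ih N hN hs) hV hV'

theorem Proper.inst {M V : Term P K} (hM : Proper M) (hV : Proper V) : Proper (M.inst V) :=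
  hM.subst fun x => by
    cases x
    · exact hV
    · exact .var _

theorem Proper.mergeSub {V : Term P K} (h : Proper V) (a b x : ℕ) :
    Proper (mergeSub a b V x) := by
  unfold Term.mergeSub
  split_ifs
  · exact .var _
  · exact h.rename _
  · exact .var _

theorem Proper.of_rename {M : Term P K} {f : ℕ → ℕ} (h : Proper (M.rename f)) : Proper M := by
  induction M using Term.induction_mem generalizing f with
  | const c => exact .const c
  | var x => exact .var x
  | lam σ M ih => cases h with | lam _ _ h => exact .lam _ _ (ih h)
  | app M N ihM ihN => cases h with | app _ _ h h' => exact .app _ _ (ihM h) (ihN h')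
  | letin M N ihM ihN => cases h with | letin _ _ h h' => exact .letin _ _ (ihM h) (ihN h')
  | box σs Ns M ih _ =>
    rw [Term.rename, renameList_eq_map] at h
    cases h with
    | box _ _ _ hl h hV hV' =>
      exact .box _ _ _ (by simpa using hl)
        (fun N hN => ih N hN (h _ (List.mem_map_of_mem hN))) hV hV'

/-- Ensures that reduction inside a box leaves its body a value. -/
theorem Step.value {M N : Term P K} (h : Step M N) (hM : Value M) : Value N := by
  induction h with
  | rule h =>
    cases h with
    | id_let | beta_let | beta_imp | comp => cases hM
    | eta_imp _ _ hV => exact hV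
    | let_ C A hC hA =>
      cases C with
      | appL | appR => cases hM
      | box σs Vs Ms M => cases hM with | box _ _ _ h => exact absurd (h A (by simp)) hA
    | id_box σ M => cases hM with | box _ _ _ h => exact h _ (by simp)
    | beta_box ρs τs υs σ Ws Ns Ps V M =>
      cases hM with
      | box _ _ _ h =>
      cases h (.box τs Ns V) (by simp) with
      | box _ _ _ h' =>
      refine .box _ _ _ fun N hN => ?_
      simp only [List.mem_append] at hN
      obtain (hN | hN) | hN := hN
      · exact h _ (by simp [hN])
      · exact h' _ hN
      · exact h _ (by simp [hN])
  | lam => exact .lam _ _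
  | appL | appR | letL | letR => cases hM
  | boxArg σs Ps Qs M _ ih =>
    cases hM with
    | box _ _ _ h =>
    refine .box _ _ _ fun N hN => ?_
    simp only [List.mem_append, List.mem_cons] at hN
    obtain hN | rfl | hN := hN
    · exact h _ (by simp [hN])
    · exact ih (h _ (by simp))
    · exact h _ (by simp [hN])
  | boxBody => cases hM with | box _ _ _ h => exact .box _ _ _ h

theorem Rule.proper {M N : Term P K} (h : Rule M N) (hM : Proper M) : Proper N := by
  cases h with
  | id_let => cases hM with | letin _ _ h _ => exact h
  | beta_let => cases hM with | letin _ _ h h' => exact h'.inst h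
  | beta_imp =>
    cases hM with | app _ _ h h' =>
    cases h with | lam _ _ h => exact h.inst h'
  | eta_imp =>
    cases hM with | lam _ _ h =>
    cases h with | app _ _ h _ => exact h.of_rename
  | comp L N M =>
    cases hM with | letin _ _ h hM =>
    cases h with | letin _ _ hL hN => exact .letin _ _ hL (.letin _ _ hN (hM.rename _))
  | let_ C A hC hA =>
    cases C with
    | appL => cases hM with | app _ _ h h' => exact .letin _ _ h (.app _ _ (.var 0) (h'.rename _))
    | appR => cases hM with | app _ _ h h' => exact .letin _ _ h' (.app _ _ (h.rename _) (.var 0))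
    | box σs Vs Ms M =>
      cases hM with
      | box _ _ _ hl h hV hV' =>
      refine .letin _ _ (h _ (by simp)) (.box _ _ _ (by simpa using hl) (fun N hN => ?_) hV hV')
      simp only [List.mem_append, List.mem_cons, List.mem_map] at hN
      obtain ⟨N, hN, rfl⟩ | rfl | ⟨N, hN, rfl⟩ := hN
      · exact (h _ (by simp [hN])).rename _
      · exact .var 0
      · exact (h _ (by simp [hN])).rename _
  | id_box σ M => cases hM with | box _ _ _ _ h => exact h _ (by simp)
  | beta_box ρs τs υs σ Ws Ns Ps V M hl hW hV =>
    cases hM with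
    | box _ _ _ hl h hM hM' =>
    cases h (.box τs Ns V) (by simp) with
    | box _ _ _ hl' h' _ hV' =>
    refine .box _ _ _ (by simp at hl ⊢; omega) (fun N hN => ?_) (hM.subst (hV.mergeSub _ _))
      (hM'.subst (hV'.mergeSub _ _))
    simp only [List.mem_append] at hN
    obtain (hN | hN) | hN := hN
    · exact h _ (by simp [hN])
    · exact h' _ hN
    · exact h _ (by simp [hN])

theorem Step.proper {M N : Term P K} (h : Step M N) (hM : Proper M) : Proper N := by
  induction h with
  | rule h => exact h.proper hM
  | lam _ _ ih => cases hM with | lam _ _ h => exact .lam _ _ (ih h)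
  | appL _ _ ih => cases hM with | app _ _ h h' => exact .app _ _ (ih h) h'
  | appR _ _ ih => cases hM with | app _ _ h h' => exact .app _ _ h (ih h')
  | letL _ _ ih => cases hM with | letin _ _ h h' => exact .letin _ _ (ih h) h'
  | letR _ _ ih => cases hM with | letin _ _ h h' => exact .letin _ _ h (ih h')
  | boxBody _ _ hs ih =>
    cases hM with | box _ _ _ hl h hV hV' => exact .box _ _ _ hl h (hs.value hV) (ih hV')
  | boxArg σs Ps Qs M _ ih =>
    cases hM with
    | box _ _ _ hl h hV hV' =>
    refine .box _ _ _ (by simpa using hl) (fun N hN => ?_) hV hV'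
    simp only [List.mem_append, List.mem_cons] at hN
    obtain hN | rfl | hN := hN
    · exact h _ (by simp [hN])
    · exact ih (h _ (by simp))
    · exact h _ (by simp [hN])

-- From reduction to parallel reduction

namespace Anf

theorem appNf_pure_left {m : Anf P K} (hm : Pure m) (n : Anf P K) :
    appNf m n = bind n (call (m.ren Nat.succ) (var 0) (var 0)) := by
  have h : ∀ x, Pure (scons m var x) := Pure.scons hm fun _ => trivial
  rw [appNf, bind_pure hm, subst_bind _ _ h, ren_succ_subst_scons, subst_var]
  rfl

theorem appNf_pure {m n : Anf P K} (hm : Pure m) (hn : Pure n) :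
    appNf m n = call m n (var 0) := by
  rw [appNf_pure_left hm, bind_pure hn, subst, ren_succ_subst_scons, subst_var]
  rfl

theorem iterate_up (n : ℕ) (s : ℕ → Anf P K) (x : ℕ) :
    up^[n] s x = if x < n then var x else (s (x - n)).ren (· + n) := by
  induction n generalizing x with
  | zero => exact (ren_id (s x)).symm
  | succ n ih =>
    rw [Function.iterate_succ_apply']
    cases x with
    | zero => simp
    | succ x =>
      simp only [up_succ, ih, Nat.add_lt_add_iff_right, Nat.add_sub_add_right]
      split
      · rfl
      · rw [ren_ren]; rfl

end Anf

theorem Term.nf_mergeSub (a b : ℕ) (V : Term P K) :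
    (fun x => nf (mergeSub a b V x)) =
      Anf.up^[a] (Anf.scons (nf V) fun x => Anf.var (x + b)) := by
  funext x
  rw [Anf.iterate_up]
  unfold mergeSub
  split_ifs with h h'
  · simp [nf]
  · subst h'
    simp [nf_rename, add_comm]
  · obtain ⟨y, rfl⟩ : ∃ y, x = a + (y + 1) := ⟨x - a - 1, by omega⟩
    simp only [nf, Nat.add_sub_cancel_left, Anf.scons_succ, Anf.ren]
    congr 1; omega

/-- For `id_let`, `beta_let`, `comp` and `let_` the two translations are equal; only β, η and the
box rules use a genuine contraction. -/
theorem Rule.par_nf {M N : Term P K} (h : Rule M N) (hM : Proper M) :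
    Anf.Par (nf M) (nf N) Anf.var := by
  cases h with
  | id_let =>
    simp only [nf, Anf.bind_var_zero]
    exact .refl _
  | beta_let V M hV =>
    rw [nf, Anf.bind_pure hV.pure_nf, nf_inst hV]
    exact .refl _
  | beta_imp σ M V hV =>
    rw [nf_inst hV, nf, nf, Anf.appNf_pure (m := .lam σ (nf M)) trivial hV.pure_nf]
    have := Anf.Par.beta (.refl (.lam σ (nf M))) (.refl (nf V)) (.refl (.var 0)) hV.pure_nf
    rwa [Anf.bind_var_zero] at this
  | eta_imp σ _ hV =>
    simp only [nf, shift, nf_rename]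
    rw [Anf.appNf_pure (n := .var 0) (hV.pure_nf.ren _) trivial]
    exact .eta σ hV.pure_nf (.refl _)
  | comp L N M =>
    simp only [nf, Anf.bind_assoc, nf_rename]
    exact .refl _
  | let_ C A hC hA =>
    cases C with
    | appL M =>
      simp only [Ctx.fill, Ctx.shift, nf, shift, nf_rename]
      rw [Anf.appNf_pure_left (m := .var 0) trivial]
      exact .refl _
    | appR V =>
      simp only [Ctx.fill, Ctx.shift, nf, shift, nf_rename]
      rw [Anf.appNf_pure_left (Value.pure_nf hC),
        Anf.appNf_pure (n := .var 0) ((Value.pure_nf hC).ren _) trivial]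
      exact .refl _
    | box σs Vs Ms M =>
      simp only [Ctx.fill, Ctx.shift, nf, nf_box, List.map_append, List.map_cons]
      rw [Anf.boxNf_eq_bind _ (by simpa using fun V hV => (hC V hV).pure_nf)]
      simp only [List.map_map, Function.comp_def, shift, nf_rename]
      exact .refl _
  | id_box σ =>
    rw [nf_box]
    -- `nf N` may run calls first, so the trivial box surrounds only its result; it is contracted
    -- inside the continuation.
    have := Anf.Par.bindK (.refl (nf N)) (k := fun _ v => .box (.cons σ v .nil) (.var 0))
      (k' := fun _ v => v) (fun _ _ _ _ _ _ _ => rfl) fun _ _ _ hv h => .idBox σ hv h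
    rw [show Anf.bindK (nf N) (fun _ v => v) = nf N from Anf.bind_var_zero _] at this
    simpa [Anf.boxNf, Anf.seqK, Anf.mkArgs, nf] using this
  | beta_box ρs τs υs σ Ws Ns Ps V M hl hW hV =>
    cases hM with
    | box _ _ _ _ h _ _ =>
    cases h (.box τs Ns V) (by simp) with
    | box _ _ _ hl' _ _ _ =>
    simp only [nf_box, List.map_append, List.map_cons, nf_subst (hV.mergeSub _ _), nf_mergeSub]
    have := Anf.boxNf_flat (ρs := ρs) (τs := τs) (υs := υs) (σ := σ) (ws := Ws.map nf)
      (ns := Ns.map nf) (ps := Ps.map nf) (by simpa using hl) (by simpa using hl')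
      (by simpa using fun V hV => (hW V hV).pure_nf) (nf V) (nf M)
    simpa using this

theorem Step.par_nf {M N : Term P K} (h : Step M N) (hM : Proper M) :
    Anf.Par (nf M) (nf N) Anf.var := by
  have refl (Ns : List (Term P K)) : List.Forall₂ (Anf.Par · · Anf.var) (Ns.map nf) (Ns.map nf) :=
    List.forall₂_same.2 fun _ _ => .refl _
  induction h with
  | rule h => exact h.par_nf hM
  | lam σ _ ih => cases hM with | lam _ _ h => simpa only [nf] using .lam σ (ih h)
  | appL _ _ ih => cases hM with | app _ _ h h' => simpa only [nf] using (ih h).appNf (.refl _)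
  | appR _ _ ih => cases hM with | app _ _ h h' => simpa only [nf] using .appNf (.refl _) (ih h')
  | letL _ _ ih => cases hM with | letin _ _ h h' => simpa only [nf] using (ih h).bind (.refl _)
  | letR _ _ ih => cases hM with | letin _ _ h h' => simpa only [nf] using .bind (.refl _) (ih h')
  | boxBody σs Ns _ ih =>
    cases hM with
    | box _ _ _ hl h hV hV' =>
      simp only [nf_box]
      exact .boxNf σs (refl _) (ih hV')
  | boxArg σs Ps Qs M _ ih =>
    cases hM with
    | box _ _ _ hl h hV hV' =>
      simp only [nf_box, List.map_append, List.map_cons]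
      exact .boxNf σs (List.rel_append (refl _) (.cons (ih (h _ (by simp))) (refl _))) (.refl _)

end LambdaBox

-- Typing and values of translated terms

namespace LambdaBox

open Term (liftRen liftSub)

variable {P K : Type*}

namespace Anf

open Kind

section Typing

variable {tc : K → Ty P}

theorem HasT.mkArgs {Γ σs : List (Ty P)} {vs : List (Anf P K)}
    (h : List.Forall₂ (fun v σ => HasT tc Γ v (val (.nec σ))) vs σs) :
    HasT tc Γ (mkArgs σs vs) (args σs) := by
  induction h with
  | nil => exact .nil _
  | cons h _ ih => exact .cons h ih

theorem HasT.seqK {Γ Δ σs ρs : List (Ty P)} {κ : Kind P} (hκ : ∃ ρ, κ = comp ρ)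
    {ts acc : List (Anf P K)} {f : ℕ → ℕ} {k : (ℕ → ℕ) → List (Anf P K) → Anf P K}
    (ht : List.Forall₂ (fun t σ => HasT tc Γ t (comp (.nec σ))) ts σs)
    (hf : ∀ x (τ : Ty P), Γ[x]? = some τ → Δ[f x]? = some τ)
    (ha : List.Forall₂ (fun v σ => HasT tc Δ v (val (.nec σ))) acc ρs)
    (hk : ∀ g vs Δ, List.Forall₂ (fun v σ => HasT tc Δ v (val (.nec σ))) vs (ρs ++ σs) →
      HasT tc Δ (k g vs) κ) : HasT tc Δ (seqK k ts f acc) κ := by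
  induction ht generalizing f acc ρs Δ with
  | nil => exact hk _ _ _ (by simpa using ha)
  | @cons t σ ts σs h _ ih =>
    refine (h.ren hf).bindK hκ fun g v Δ' hg hv => ?_
    refine ih (ρs := ρs ++ [σ]) (fun x τ hx => hg _ _ (hf _ _ hx)) ?_ (by simpa using hk)
    refine List.rel_append ?_ (.cons hv .nil)
    rw [List.forall₂_map_left_iff]
    exact ha.imp fun _ _ h => h.ren hg

theorem HasT.appNf {Γ : List (Ty P)} {σ τ : Ty P} {m n : Anf P K}
    (hm : HasT tc Γ m (comp (.imp σ τ))) (hn : HasT tc Γ n (comp σ)) :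
    HasT tc Γ (appNf m n) (comp τ) :=
  hm.bind ((hn.ren_succ _).bind (.call (.var rfl) (.var rfl) (.ret (.var rfl))))

end Typing

/-- The entries of an argument list. -/
def entries : Anf P K → List (Anf P K)
  | cons _ V as => V :: entries as
  | _ => []

/-- The types of an argument list. -/
def tys : Anf P K → List (Ty P)
  | cons σ _ as => σ :: tys as
  | _ => []

/-- Values. -/
inductive IsVal : Anf P K → Prop
  | const (c : K) : IsVal (const c)
  | var (x : ℕ) : IsVal (var x)
  | lam (σ : Ty P) (N : Anf P K) : IsVal (lam σ N)
  | box (as M : Anf P K) : (∀ V ∈ entries as, IsVal V) → IsVal (box as M)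

/-- Terms whose result is a value. -/
def IsComp : Anf P K → Prop
  | call _ _ N => IsComp N
  | v => IsVal v

theorem IsVal.pure {v : Anf P K} (h : IsVal v) : Pure v := by
  cases h <;> trivial

theorem IsVal.isComp {v : Anf P K} (h : IsVal v) : IsComp v := by
  cases h
  · exact IsVal.const _
  · exact IsVal.var _
  · exact IsVal.lam _ _
  · exact IsVal.box _ _ (by assumption)

theorem IsComp.isVal {t : Anf P K} (h : IsComp t) (ht : Pure t) : IsVal t := by
  cases t <;> first | exact h | exact ht.elim

theorem tys_ren (f : ℕ → ℕ) (t : Anf P K) : tys (t.ren f) = tys t := by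
  induction t <;> simp_all [tys, ren]

theorem IsVal.entries_eq {v : Anf P K} (h : IsVal v) : entries v = [] := by
  cases h <;> rfl

theorem IsVal.tys_eq {v : Anf P K} (h : IsVal v) : tys v = [] := by
  cases h <;> rfl

theorem entries_subst {s : ℕ → Anf P K} (hs : ∀ x, IsVal (s x)) (t : Anf P K) :
    entries (t.subst s) = (entries t).map (subst s) := by
  induction t generalizing s with
  | var x => exact (hs x).entries_eq
  | _ => simp_all [entries, subst]

theorem tys_subst {s : ℕ → Anf P K} (hs : ∀ x, IsVal (s x)) (t : Anf P K) :
    tys (t.subst s) = tys t := by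
  induction t generalizing s with
  | var x => exact (hs x).tys_eq
  | _ => simp_all [tys, subst]

theorem IsVal.subst {v : Anf P K} (h : IsVal v) {s : ℕ → Anf P K} (hs : ∀ x, IsVal (s x)) :
    IsVal (v.subst s) := by
  induction h with
  | const c => exact .const c
  | var x => exact hs x
  | lam σ N => exact .lam _ _
  | box as M _ ih =>
    refine .box _ _ ?_
    rw [entries_subst hs]
    simpa using ih

theorem IsVal.ren {v : Anf P K} (h : IsVal v) (f : ℕ → ℕ) : IsVal (v.ren f) := by
  rw [ren_eq_subst]; exact h.subst fun _ => .var _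

theorem IsVal.up {s : ℕ → Anf P K} (hs : ∀ x, IsVal (s x)) (x : ℕ) : IsVal (up s x) := by
  cases x
  · exact .var 0
  · exact (hs _).ren _

theorem IsVal.scons {v : Anf P K} {s : ℕ → Anf P K} (hv : IsVal v) (hs : ∀ x, IsVal (s x))
    (x : ℕ) : IsVal (scons v s x) := by
  cases x
  · exact hv
  · exact hs _

theorem IsComp.subst {t : Anf P K} (h : IsComp t) {s : ℕ → Anf P K} (hs : ∀ x, IsVal (s x)) :
    IsComp (t.subst s) := by
  induction t generalizing s with
  | call V W N _ _ ih => exact ih h (IsVal.up hs)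
  | _ => exact (IsVal.subst (h.isVal trivial) hs).isComp

theorem IsComp.ren {t : Anf P K} (h : IsComp t) (f : ℕ → ℕ) : IsComp (t.ren f) := by
  rw [ren_eq_subst]; exact h.subst fun _ => .var _

theorem IsComp.bindK {t : Anf P K} (h : IsComp t) {k : (ℕ → ℕ) → Anf P K → Anf P K}
    (hk : ∀ f v, IsVal v → IsComp (k f v)) : IsComp (bindK t k) := by
  induction t generalizing k with
  | call V W N _ _ ih => exact ih h fun f v => hk _ v
  | _ => exact hk _ _ (h.isVal trivial)

theorem IsComp.bind {t N : Anf P K} (h : IsComp t) (hN : IsComp N) : IsComp (bind t N) :=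
  h.bindK fun _ _ hv => hN.subst (IsVal.scons hv fun _ => .var _)

theorem IsComp.seqK {ts : List (Anf P K)} (h : ∀ t ∈ ts, IsComp t) {acc : List (Anf P K)}
    (ha : ∀ v ∈ acc, IsVal v) {k : (ℕ → ℕ) → List (Anf P K) → Anf P K} {f : ℕ → ℕ}
    (hk : ∀ g vs, (∀ v ∈ vs, IsVal v) → IsComp (k g vs)) : IsComp (seqK k ts f acc) := by
  induction ts generalizing f acc with
  | nil => exact hk _ _ ha
  | cons t ts ih =>
    refine ((h t (by simp)).ren f).bindK fun g v hv => ih (fun t ht => h t (by simp [ht])) ?_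
    simp only [List.mem_append, List.mem_map, List.mem_singleton]
    rintro w (⟨w, hw, rfl⟩ | rfl)
    · exact (ha w hw).ren g
    · exact hv

theorem mem_entries_mkArgs {σs : List (Ty P)} {vs : List (Anf P K)} {v : Anf P K}
    (h : v ∈ entries (mkArgs σs vs)) : v ∈ vs := by
  induction σs generalizing vs with
  | nil => simp [mkArgs, entries] at h
  | cons σ σs ih =>
    cases vs with
    | nil => simp [mkArgs, entries] at h
    | cons w vs =>
      simp only [mkArgs, entries, List.mem_cons] at h ⊢
      exact h.imp_right ih

/-- The claims for the three judgements depend on one another and are proved in one induction. -/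
theorem HasT.isVal_and {tc : K → Ty P} {Γ : List (Ty P)} {t : Anf P K} {κ : Kind P}
    (h : HasT tc Γ t κ) : match κ with
      | val _ => IsVal t
      | comp _ => IsComp t
      | args _ => ∀ V ∈ entries t, IsVal V := by
  induction h with
  | const | var | lam => constructor
  | ret _ ih => exact ih.isComp
  | call _ _ _ _ _ ih => exact ih
  | box _ _ ih _ => exact .box _ _ ih
  | nil => simp [entries]
  | cons _ _ ihV ih => simpa [entries] using ⟨ihV, ih⟩

theorem HasT.isVal {tc : K → Ty P} {Γ : List (Ty P)} {t : Anf P K} {τ : Ty P}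
    (h : HasT tc Γ t (val τ)) : IsVal t := h.isVal_and

theorem HasT.isComp {tc : K → Ty P} {Γ : List (Ty P)} {t : Anf P K} {τ : Ty P}
    (h : HasT tc Γ t (comp τ)) : IsComp t := h.isVal_and

theorem HasT.isVal_of_mem_entries {tc : K → Ty P} {Γ : List (Ty P)} {t : Anf P K}
    {σs : List (Ty P)} (h : HasT tc Γ t (args σs)) : ∀ V ∈ entries t, IsVal V := h.isVal_and

end Anf

open Anf.Kind in
theorem HasType.nf {tc : K → Ty P} {Γ : List (Ty P)} {M : Term P K} {τ : Ty P}
    (h : HasType tc Γ M τ) (hM : Proper M) : Anf.HasT tc Γ M.nf (comp τ) := by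
  induction h with
  | const => exact .ret (.const _ _)
  | var _ _ _ h => exact .ret (.var h)
  | lam _ _ _ _ _ ih => cases hM with | lam _ _ h => exact .ret (.lam (ih h))
  | app _ _ _ _ _ _ _ ih ih' => cases hM with | app _ _ h h' => exact (ih h).appNf (ih' h')
  | letin _ _ _ _ _ _ _ ih ih' => cases hM with | letin _ _ h h' => exact (ih h).bind (ih' h')
  | box Γ σs τ Ns M _ hl _ ihM ih =>
    cases hM with
    | box _ _ _ _ h hV hV' =>
    rw [Term.nf_box]
    refine Anf.HasT.seqK (σs := σs) (ρs := []) ⟨_, rfl⟩ ?_ (fun _ _ h => h) .nil fun g vs Δ hvs =>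
      .ret (.box (Anf.HasT.mkArgs hvs) ((ihM hV').val_of_pure hV.pure_nf))
    rw [List.forall₂_map_left_iff, List.forall₂_iff_zip]
    exact ⟨hl, fun {N σ} hN => ih (N, σ) hN (h _ (List.of_mem_zip hN).1)⟩

theorem Proper.isComp_nf {M : Term P K} (h : Proper M) : M.nf.IsComp := by
  induction h with
  | const c => exact Anf.IsVal.const c
  | var x => exact Anf.IsVal.var x
  | lam σ M => exact Anf.IsVal.lam _ _
  | app M N _ _ ihM ihN => exact ihM.bind ((ihN.ren _).bind (Anf.IsVal.var 0))
  | letin N M _ _ ihN ihM => exact ihN.bind ihM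
  | box σs Ns M _ _ _ _ ih _ =>
    rw [Term.nf_box]
    exact Anf.IsComp.seqK (by simpa using ih) (by simp) fun g vs hvs =>
      Anf.IsVal.box _ _ fun v hv => hvs v (Anf.mem_entries_mkArgs hv)

end LambdaBox

-- Reading normal forms back as terms

namespace LambdaBox

open Term (liftRen liftSub)

variable {P K : Type*}

/-- Many-step reduction. -/
abbrev Steps : Term P K → Term P K → Prop := Relation.ReflTransGen Step

theorem Steps.map {f : Term P K → Term P K} (hf : ∀ M M', Step M M' → Step (f M) (f M'))
    {M M' : Term P K} (h : Steps M M') : Steps (f M) (f M') := by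
  induction h with
  | refl => exact .refl
  | tail _ h ih => exact ih.tail (hf _ _ h)

theorem Steps.lam (σ : Ty P) {M M' : Term P K} (h : Steps M M') :
    Steps (.lam σ M) (.lam σ M') := h.map fun _ _ => Step.lam σ

theorem Steps.app {M M' N N' : Term P K} (hM : Steps M M') (hN : Steps N N') :
    Steps (.app M N) (.app M' N') :=
  (hM.map (f := fun M => .app M N) fun _ _ => Step.appL N).trans
    (hN.map fun _ _ => Step.appR M')

theorem Steps.letin {M M' N N' : Term P K} (hN : Steps N N') (hM : Steps M M') :
    Steps (.letin N M) (.letin N' M') :=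
  (hN.map (f := fun N => .letin N M) fun _ _ => Step.letL M).trans
    (hM.map fun _ _ => Step.letR N')

theorem Steps.boxArg (σs : List (Ty P)) (Ps Qs : List (Term P K)) {N N' : Term P K}
    (M : Term P K) (h : Steps N N') :
    Steps (.box σs (Ps ++ N :: Qs) M) (.box σs (Ps ++ N' :: Qs) M) :=
  h.map (f := fun N => .box σs (Ps ++ N :: Qs) M) fun _ _ => Step.boxArg σs Ps Qs M

theorem Steps.boxBody (σs : List (Ty P)) (Ns : List (Term P K)) {M M' : Term P K}
    (h : Steps M M') : Steps (.box σs Ns M) (.box σs Ns M') :=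
  h.map fun _ _ => Step.boxBody σs Ns

theorem Steps.boxArgs (σs : List (Ty P)) (Ps : List (Term P K)) {Ns Ns' : List (Term P K)}
    (M : Term P K) (h : List.Forall₂ Steps Ns Ns') :
    Steps (.box σs (Ps ++ Ns) M) (.box σs (Ps ++ Ns') M) := by
  induction h generalizing Ps with
  | nil => exact .refl
  | @cons N N' Ns Ns' h _ ih =>
    exact (Steps.boxArg σs Ps Ns M h).trans (by simpa using ih (Ps ++ [N']))

theorem Steps.rule {M N : Term P K} (h : Rule M N) : Steps M N := .single (.rule h)

namespace Term

/-- `let x = A in B`, or `A` if `B` is `x`. -/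
def seq (A : Term P K) : Term P K → Term P K
  | var 0 => A
  | B => letin A B

theorem seq_eq (A : Term P K) {B : Term P K} (hB : B ≠ var 0) : seq A B = letin A B := by
  unfold seq
  split
  · exact absurd rfl hB
  · rfl

theorem steps_seq (A B : Term P K) : Steps (letin A B) (seq A B) := by
  by_cases h : B = var 0
  · subst h; exact .rule (.id_let A)
  · rw [seq_eq A h]

/-- A lifted substitution sends no index other than `0` to `var 0`, since the other images are
weakened; the case distinction in `seq` is therefore stable. -/
theorem subst_seq (A B : Term P K) (s : ℕ → Term P K) :
    (seq A B).subst s = seq (A.subst s) (B.subst (liftSub s)) := by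
  by_cases h : B = var 0
  · subst h; rfl
  · rw [seq_eq A h, seq_eq, subst]
    intro h'
    cases B with
    | var x =>
      cases x with
      | zero => exact h rfl
      | succ x =>
        simp only [subst, liftSub, shift] at h'
        cases e : s x <;> simp [e, rename] at h'
    | _ => simp [subst] at h'

theorem rename_seq (A B : Term P K) (f : ℕ → ℕ) :
    (seq A B).rename f = seq (A.rename f) (B.rename (liftRen f)) := by
  by_cases h : B = var 0
  · subst h; rfl
  · rw [seq_eq A h, seq_eq, rename]
    intro h'
    cases B with
    | var x =>
      cases x with
      | zero => exact h rfl
      | succ x => simp [rename, liftRen] at h'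
    | _ => simp [rename] at h'

theorem not_value_seq_app (A B C : Term P K) : ¬ Value (seq (app A B) C) := by
  by_cases h : C = var 0
  · subst h; rintro ⟨⟩
  · rw [seq_eq _ h]; rintro ⟨⟩

end Term

namespace Anf

open Term (seq)

mutual
/-- The term represented by an `Anf`. -/
def emb : Anf P K → Term P K
  | const c => .const c
  | var x => .var x
  | lam σ N => .lam σ (emb N)
  | call V W N => seq (.app (emb V) (emb W)) (emb N)
  | box as M => .box (tys as) (embs as) (emb M)
  -- Argument lists are not terms. The default is a closed term different from `var 0`, so that
  -- `emb` still commutes with renaming and substitution and `eq_var_zero_of_emb` has no exceptions.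
  | nil => .box [] [] (.var 0)
  | cons _ _ _ => .box [] [] (.var 0)
/-- The terms represented by an argument list. -/
def embs : Anf P K → List (Term P K)
  | cons _ V as => emb V :: embs as
  | _ => []
end

theorem embs_eq_map (t : Anf P K) : embs t = (entries t).map emb := by
  induction t <;> simp_all [embs, entries]

theorem emb_ren (f : ℕ → ℕ) (t : Anf P K) : emb (t.ren f) = (emb t).rename f ∧
    embs (t.ren f) = (embs t).map (Term.rename f) := by
  induction t generalizing f <;>
    simp_all [emb, embs, ren, Term.rename, Term.rename_seq, tys_ren, Term.renameList_eq_map]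

theorem emb_up (s : ℕ → Anf P K) : (fun x => emb (up s x)) = liftSub fun x => emb (s x) := by
  funext x; cases x
  · simp [emb, liftSub]
  · simp [liftSub, (emb_ren _ _).1, Term.shift]

theorem emb_subst_and {s : ℕ → Anf P K} (hs : ∀ x, IsVal (s x)) (t : Anf P K) :
    emb (t.subst s) = (emb t).subst (fun x => emb (s x)) ∧
      embs (t.subst s) = (embs t).map (Term.subst fun x => emb (s x)) := by
  induction t generalizing s with
  | var x => simp [emb, embs, subst, Term.subst, embs_eq_map, (hs x).entries_eq]
  | lam σ N ih => simp [emb, embs, subst, Term.subst, ih (IsVal.up hs), emb_up]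
  | call V W N ihV ihW ih =>
    simp [emb, embs, subst, Term.subst, ihV hs, ihW hs, ih (IsVal.up hs), emb_up, Term.subst_seq]
  | _ => simp_all [emb, embs, subst, Term.subst, tys_subst, Term.substList_eq_map]

theorem emb_subst {s : ℕ → Anf P K} (hs : ∀ x, IsVal (s x)) (t : Anf P K) :
    emb (t.subst s) = (emb t).subst fun x => emb (s x) := (emb_subst_and hs t).1

theorem emb_inst {v : Anf P K} (hv : IsVal v) (t : Anf P K) :
    emb (t.subst (scons v var)) = (emb t).inst (emb v) := by
  rw [emb_subst (IsVal.scons hv .var), Term.inst]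
  congr 1; funext x; cases x <;> simp [emb, Term.single]

theorem eq_var_zero_of_emb {t : Anf P K} (h : emb t = .var 0) : t = var 0 := by
  cases t with
  | var x => simpa [emb] using h
  | call V W N =>
    rw [emb] at h
    exact absurd (h ▸ Value.var 0) (Term.not_value_seq_app _ _ _)
  | _ => simp [emb] at h

theorem IsVal.value {v : Anf P K} (h : IsVal v) : Value (emb v) := by
  induction h with
  | const c => rw [emb]; exact .const c
  | var x => rw [emb]; exact .var x
  | lam σ N => rw [emb]; exact .lam _ _
  | box as M _ ih =>
    rw [emb, embs_eq_map]
    exact .box _ _ _ (by simpa using ih)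

/-- Each call in `A` is moved outwards by `comp`, and its final value is substituted by `beta_let`.
A last call whose result is returned at once is read as a bare application, so it needs no `comp`.
-/
theorem steps_bind {A : Anf P K} (hA : IsComp A) (N : Anf P K) :
    Steps (.letin (emb A) (emb N)) (emb (bind A N)) := by
  induction A generalizing N with
  | call V W Q _ _ ih =>
    rw [bind_call]
    by_cases h : Q = var 0
    · subst h
      rw [bind_pure (by trivial), ren_liftRen_succ_subst]
      simpa [emb, seq] using Term.steps_seq _ _
    · have := ih hA (N.ren (liftRen Nat.succ))
      rw [(emb_ren _ _).1] at this
      simp only [emb]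
      rw [Term.seq_eq _ fun h' => h (eq_var_zero_of_emb h')]
      exact ((Steps.rule (.comp _ _ _)).trans (Steps.letin .refl this)).trans (Term.steps_seq _ _)
  | _ =>
    have hv := IsComp.isVal hA trivial
    rw [bind_pure hv.pure, emb_inst hv]
    exact .rule (.beta_let _ _ hv.value)

theorem not_value_emb_of_not_pure {t : Anf P K} (h : ¬ Pure t) : ¬ Value (emb t) := by
  cases t with
  | call => rw [emb]; exact Term.not_value_seq_app _ _ _
  | _ => exact absurd trivial h

/-- `let_` names first the function part and then the argument, each only if it is not pure; being
then an application or a `let`, it is indeed not a value. -/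
theorem steps_appNf {m n : Anf P K} (hm : IsComp m) (hn : IsComp n) :
    Steps (.app (emb m) (emb n)) (emb (appNf m n)) := by
  have of_pure {m n : Anf P K} (hm : IsVal m) (hn : IsComp n) :
      Steps (.app (emb m) (emb n)) (emb (appNf m n)) := by
    by_cases h : Pure n
    · rw [appNf_pure hm.pure h]
      simp only [emb, seq]
      exact .refl
    · rw [appNf_pure_left hm.pure]
      refine (Steps.rule (.let_ (.appR (emb m)) (emb n) hm.value
        (not_value_emb_of_not_pure h))).trans ?_
      have := steps_bind hn (call (m.ren Nat.succ) (var 0) (var 0))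
      simpa only [emb, seq, (emb_ren _ _).1, Ctx.shift, Ctx.fill, Term.shift] using this
  by_cases h : Pure m
  · exact of_pure (hm.isVal h) hn
  · refine (Steps.rule (.let_ (.appL (emb n)) (emb m) trivial
      (not_value_emb_of_not_pure h))).trans ?_
    have := of_pure (.var 0) (hn.ren Nat.succ)
    rw [(emb_ren _ _).1, emb] at this
    refine (Steps.letin .refl this).trans ?_
    rw [appNf_pure_left (m := var 0) trivial]
    exact steps_bind hm _

theorem tys_mkArgs {σs : List (Ty P)} {vs : List (Anf P K)} (h : σs.length = vs.length) :
    tys (mkArgs σs vs) = σs := by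
  induction σs generalizing vs with
  | nil => rfl
  | cons σ σs ih => cases vs <;> simp_all [mkArgs, tys]

theorem entries_mkArgs {σs : List (Ty P)} {vs : List (Anf P K)} (h : σs.length = vs.length) :
    entries (mkArgs σs vs) = vs := by
  induction σs generalizing vs with
  | nil => cases vs <;> simp_all [mkArgs, entries]
  | cons σ σs ih => cases vs <;> simp_all [mkArgs, entries]

/-- Induction on the number of arguments not yet examined. A pure one joins the values on the left;
any other is named by `let_` and replaced by a variable, with the rest weakened. -/
theorem steps_boxNf {σs : List (Ty P)} {vs ts : List (Anf P K)} (M : Anf P K)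
    (hl : σs.length = vs.length + ts.length) (hv : ∀ v ∈ vs, IsVal v) (ht : ∀ t ∈ ts, IsComp t) :
    Steps (.box σs (vs.map emb ++ ts.map emb) (emb M)) (emb (boxNf σs (vs ++ ts) M)) := by
  generalize hn : ts.length = n
  induction n generalizing vs ts with
  | zero =>
    obtain rfl := List.length_eq_zero_iff.1 hn
    have hl' : σs.length = vs.length := by simpa using hl
    rw [List.append_nil, boxNf, seqK_pure _ fun v h => (hv v h).pure, map_ren_id, List.nil_append,
      emb, tys_mkArgs hl', embs_eq_map, entries_mkArgs hl']
    simpa using Relation.ReflTransGen.refl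
  | succ n ih =>
    cases ts with
    | nil => simp at hn
    | cons t ts =>
    by_cases h : Pure t
    · have := ih (vs := vs ++ [t]) (ts := ts) (by simp at hl ⊢; omega)
        (by
          simp only [List.mem_append, List.mem_singleton]
          rintro v (h' | rfl)
          · exact hv v h'
          · exact (ht _ (by simp)).isVal h) (fun t h => ht t (by simp [h])) (by simpa using hn)
      simpa using this
    · rw [boxNf_eq_bind _ fun v h => (hv v h).pure]
      refine (Steps.rule (.let_ (.box σs (vs.map emb) (ts.map emb) (emb M)) (emb t)
        (by simpa [Ctx.IsSimple] using fun v h => (hv v h).value)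
        (not_value_emb_of_not_pure h))).trans ?_
      refine Relation.ReflTransGen.trans (Steps.letin .refl ?_) (steps_bind (ht t (by simp)) _)
      have := ih (vs := vs.map (ren Nat.succ) ++ [var 0]) (ts := ts.map (ren Nat.succ))
        (by simp at hl ⊢; omega)
        (by
          simp only [List.mem_append, List.mem_singleton, List.mem_map]
          rintro v (⟨w, h', rfl⟩ | rfl)
          · exact (hv w h').ren _
          · exact .var 0)
        (by simpa using fun t h => (ht t (by simp [h])).ren _) (by simpa using hn)
      simpa [Ctx.shift, Ctx.fill, Function.comp_def, (emb_ren _ _).1, emb, Term.shift] using this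

end Anf

open Anf

/-- Only administrative steps are needed: `let_` names the non-values, and `steps_bind` flattens the
resulting `let`s. -/
theorem Proper.steps_nf {M : Term P K} (h : Proper M) : Steps M M.nf.emb := by
  induction h with
  | const c => simp only [Term.nf, emb]; exact .refl
  | var x => simp only [Term.nf, emb]; exact .refl
  | lam σ M _ ih => simpa only [Term.nf, emb] using ih.lam σ
  | app M N hM hN ihM ihN =>
    rw [Term.nf]
    exact (ihM.app ihN).trans (steps_appNf hM.isComp_nf hN.isComp_nf)
  | letin N M hN _ ihN ihM =>
    rw [Term.nf]
    exact (ihN.letin ihM).trans (steps_bind hN.isComp_nf _)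
  | box σs Ns M hl h _ _ ih ihM =>
    rw [Term.nf_box]
    have h₁ := Steps.boxArgs σs [] (Ns' := (Ns.map Term.nf).map emb) M (by
      rw [List.map_map, List.forall₂_map_right_iff, List.forall₂_same]
      exact ih)
    have h₂ := steps_boxNf (σs := σs) (vs := []) (ts := Ns.map Term.nf) M.nf (by simpa using hl)
      (by simp) (by simpa using fun N hN => (h N hN).isComp_nf)
    exact (h₁.trans (Steps.boxBody _ _ ihM)).trans h₂

theorem Anf.iterate_up_subst (n : ℕ) (s s' : ℕ → Anf P K) :
    Anf.up^[n] (fun x => (s x).subst s') = fun x => (Anf.up^[n] s x).subst (Anf.up^[n] s') := by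
  induction n with
  | zero => rfl
  | succ n ih => simp only [Function.iterate_succ_apply', ih, up_subst]

theorem Anf.IsVal.iterate_up {s : ℕ → Anf P K} (hs : ∀ x, IsVal (s x)) (n x : ℕ) :
    IsVal (Anf.up^[n] s x) := by
  induction n generalizing x with
  | zero => exact hs x
  | succ n ih => rw [Function.iterate_succ_apply']; exact IsVal.up ih x

theorem Anf.emb_mergeSub (a b : ℕ) (U : Anf P K) :
    (fun x => emb (Anf.up^[a] (Anf.scons U fun x => Anf.var (x + b)) x)) =
      Term.mergeSub a b (emb U) := by
  funext x
  rw [Anf.iterate_up]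
  unfold Term.mergeSub
  split_ifs with h h'
  · simp [emb]
  · subst h'
    simp [(emb_ren _ _).1, add_comm]
  · obtain ⟨y, rfl⟩ : ∃ y, x = a + (y + 1) := ⟨x - a - 1, by omega⟩
    simp only [emb, Nat.add_sub_cancel_left, scons_succ, ren]
    congr 1; omega

theorem Anf.Spine.entries_append {as : Anf P K} (h : Spine as) (bs : Anf P K) :
    entries (Anf.append as bs) = entries as ++ entries bs := by
  induction as <;> simp_all [Anf.append, entries, Spine]

theorem Anf.Spine.tys_append {as : Anf P K} (h : Spine as) (bs : Anf P K) :
    tys (Anf.append as bs) = tys as ++ tys bs := by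
  induction as <;> simp_all [Anf.append, tys, Spine]

theorem Anf.length_entries (t : Anf P K) : (entries t).length = len t := by
  induction t <;> simp_all [entries, len]

theorem Anf.length_tys (t : Anf P K) : (tys t).length = len t := by
  induction t <;> simp_all [tys, len]

/-- Contracting an argument which is a box, followed by a substitution for the later arguments. -/
theorem Anf.HasT.subst_flat {tc : K → Ty P} {τs : List (Ty P)} {U : Anf P K} {κ : Kind P}
    (hU : HasT tc τs U κ) (a : ℕ) (θ : ℕ → Anf P K) (M : Anf P K) :
    (M.subst (Anf.up^[a] (Anf.scons U fun x => Anf.var (x + τs.length)))).subst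
        (Anf.up^[a + τs.length] θ) =
      M.subst (Anf.up^[a] (Anf.scons U fun x => (θ x).ren (· + τs.length))) := by
  rw [subst_subst, Function.iterate_add_apply, ← iterate_up_subst]
  congr 2
  funext x; cases x with
  | zero =>
    rw [scons_zero, scons_zero, hU.subst_congr (s' := Anf.var), subst_var]
    intro x hx
    simp [Anf.iterate_up, hx]
  | succ x => simp [Anf.subst, Anf.iterate_up]

open Anf.Kind in
/-- Parallel reduction of typed terms is reduction of the represented terms. -/
theorem Anf.Par.steps {tc : K → Ty P} {t t' : Anf P K} {θ : ℕ → Anf P K} (h : Par t t' θ) :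
    (∀ Γ τ, HasT tc Γ t (comp τ) → Steps (emb t) (emb t')) ∧
    ∀ Γ σs, HasT tc Γ t (args σs) → ∀ (ρs : List (Ty P)) (Ws : List (Term P K)) (M : Anf P K),
      ρs.length = Ws.length → (∀ W ∈ Ws, Value W) →
      Steps (.box (ρs ++ tys t) (Ws ++ embs t) (emb M))
        (.box (ρs ++ tys t') (Ws ++ embs t') (emb (M.subst (Anf.up^[Ws.length] θ)))) := by
  induction h with
  | const | var => exact ⟨fun _ _ _ => .refl, fun _ _ ht => nomatch ht⟩
  | lam σ _ ih =>
    refine ⟨fun Γ τ ht => ?_, fun _ _ ht => nomatch ht⟩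
    cases ht.val_of_pure trivial with
    | lam hN => simpa only [emb] using (ih.1 _ _ hN).lam σ
  | @call V V' W W' N N' _ _ hN ihV ihW ih =>
    refine ⟨fun Γ τ ht => ?_, fun _ _ ht => nomatch ht⟩
    cases ht with
    | ret ht => cases ht
    | call hV hW hNt =>
    have h₁ := (ihV.1 _ _ hV.ret).app (ihW.1 _ _ hW.ret)
    simp only [emb]
    -- A call whose result is returned at once is read without a `let`, so `letin` is available only
    -- in the other case.
    by_cases h : N = Anf.var 0
    · subst h
      cases hN
      simpa only [emb, Term.seq] using h₁
    · rw [Term.seq_eq _ fun h' => h (eq_var_zero_of_emb h')]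
      exact (h₁.letin (ih.1 _ _ hNt)).trans (Term.steps_seq _ _)
  | @beta V W W' N N' Q σ hV hW hN hp ihV ihW ih =>
    refine ⟨fun Γ τ ht => ?_, fun _ _ ht => nomatch ht⟩
    cases ht with
    | ret ht => cases ht
    | call hVt hWt hNt =>
    have hW' : IsVal W' := HasT.isVal (hWt.reduct hW)
    have h₁ := (ihV.1 _ _ hVt.ret).app (ihW.1 _ _ hWt.ret)
    rw [emb] at h₁
    have h₂ : Steps _ _ := h₁.trans (Steps.rule (.beta_imp σ (emb Q) (emb W') hW'.value))
    rw [← emb_inst hW'] at h₂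
    rw [emb]
    by_cases h : N = Anf.var 0
    · subst h
      cases hN
      rw [bind_var_zero]
      simpa only [emb, Term.seq] using h₂
    · rw [Term.seq_eq _ fun h' => h (eq_var_zero_of_emb h')]
      refine (h₂.letin (ih.1 _ _ hNt)).trans (steps_bind ?_ _)
      cases hVt.reduct hV with
      | lam hQ =>
        exact hQ.isComp.subst (IsVal.scons hW' .var)
  | @eta V V' σ hp _ ih =>
    refine ⟨fun Γ τ ht => ?_, fun _ _ ht => nomatch ht⟩
    cases ht.val_of_pure trivial with
    | lam hN =>
    have ht := hN.eta_inv
    simp only [emb, Term.seq, (emb_ren _ _).1]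
    exact (Steps.rule (.eta_imp σ (emb V) ht.isVal.value)).trans (ih.1 _ _ ht.ret)
  | box _ _ iha ihM =>
    refine ⟨fun Γ τ ht => ?_, fun _ _ ht => nomatch ht⟩
    cases ht.val_of_pure trivial with
    | box ha hM =>
    simp only [emb]
    exact (Steps.boxBody _ _ (ihM.1 _ _ hM.ret)).trans (iha.2 _ _ ha [] [] _ rfl (by simp))
  | idBox σ _ _ ih =>
    refine ⟨fun Γ τ ht => ?_, fun _ _ ht => nomatch ht⟩
    cases ht.val_of_pure trivial with
    | box ha hM =>
    cases ha with
    | cons hV _ =>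
    simp only [emb, tys, embs]
    exact (Steps.rule (.id_box σ _)).trans (ih.1 _ _ hV.ret)
  | nil =>
    refine ⟨fun Γ τ ht => (by cases ht; contradiction), fun _ _ _ ρs Ws M _ _ => ?_⟩
    have : Anf.up^[Ws.length] (Anf.var : ℕ → Anf P K) = Anf.var :=
      Function.iterate_fixed up_var _
    rw [this, Anf.subst_var]
  | @keep V V' as as' θ σ hVV _ ihV iha =>
    refine ⟨fun Γ τ ht => (by cases ht; contradiction), fun _ _ ht ρs Ws M hl hW => ?_⟩
    cases ht with
    | cons hV ha =>
    have hV' : IsVal V' := HasT.isVal (hV.reduct hVV)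
    -- Arguments are processed from left to right, because `beta_box` fires only behind values; the
    -- reduced head is a value and joins the prefix.
    have h₁ := Steps.boxArg (ρs ++ σ :: tys as) Ws (embs as) (emb M) (ihV.1 _ _ hV.ret)
    have h₂ := iha.2 _ _ ha (ρs ++ [σ]) (Ws ++ [emb V']) M (by simpa using hl) (by
      simp only [List.mem_append, List.mem_singleton]
      rintro W (h | rfl)
      · exact hW W h
      · exact hV'.value)
    simp only [tys, embs]
    refine h₁.trans ?_
    simpa using h₂
  | @flat V ns U as as' θ σ hVU _ hn _ ihV iha =>
    refine ⟨fun Γ τ ht => (by cases ht; contradiction), fun _ _ ht ρs Ws M hl hW => ?_⟩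
    cases ht with
    | cons hV ha =>
    cases hV.reduct hVU with
    | box hnt hU =>
    -- The argument is reduced to a box and contracted by `beta_box`; the later arguments are then
    -- treated behind the prefix extended by `ns`, whose entries are values by typing.
    -- `HasT.subst_flat` merges the two substitutions into the body.
    have h₁ := Steps.boxArg (ρs ++ σ :: tys as) Ws (embs as) (emb M) (ihV.1 _ _ hV.ret)
    rw [emb] at h₁
    have h₂ := h₁.trans (Steps.rule (.beta_box ρs (tys ns) (tys as) σ Ws (embs ns) (embs as)
      (emb U) (emb M) hl hW hU.isVal.value))
    have e : (embs ns).length = len ns := by rw [embs_eq_map, List.length_map, length_entries]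
    rw [e, ← emb_mergeSub, ← emb_subst
      (IsVal.iterate_up (IsVal.scons hU.isVal fun _ => .var _) _)] at h₂
    have h₃ := iha.2 _ _ ha (ρs ++ tys ns) (Ws ++ embs ns)
      (M.subst (Anf.up^[Ws.length] (Anf.scons U fun x => Anf.var (x + len ns))))
      (by rw [List.length_append, List.length_append, hl, e, length_tys]) (by
      simp only [List.mem_append]
      rintro W (h | h)
      · exact hW W h
      · rw [embs_eq_map] at h
        obtain ⟨w, hw, rfl⟩ := List.mem_map.1 h
        exact (hnt.isVal_of_mem_entries w hw).value)
    rw [List.length_append, e, hnt.len_eq, hU.subst_flat] at h₃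
    rw [hnt.len_eq] at h₂ ⊢
    simp only [tys, embs]
    refine h₂.trans ?_
    rw [hn.tys_append, embs_eq_map (Anf.append _ _), hn.entries_append, List.map_append,
      ← embs_eq_map, ← embs_eq_map, ← List.append_assoc, ← List.append_assoc]
    exact h₃

theorem par_nf_of_steps {M N : Term P K} (hM : Proper M) (h : Steps M N) :
    Proper N ∧ Relation.ReflTransGen (Par · · var) M.nf N.nf := by
  induction h with
  | refl => exact ⟨hM, .refl⟩
  | tail _ h ih => exact ⟨h.proper ih.1, ih.2.tail (h.par_nf ih.1)⟩

theorem steps_of_reflTransGen_par {tc : K → Ty P} {Γ : List (Ty P)} {τ : Ty P} {t t' : Anf P K}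
    (ht : HasT tc Γ t (.comp τ)) (h : Relation.ReflTransGen (Par · · var) t t') :
    Steps (emb t) (emb t') := by
  induction h with
  | refl => exact .refl
  | tail h h' ih => exact ih.trans (h'.steps.1 _ _ (reduct_of_reflTransGen ht h))

end LambdaBox

theorem proposition12 {P K : Type*} (tc : K → LambdaBox.Ty P)
    (Γ : List (LambdaBox.Ty P)) (τ : LambdaBox.Ty P) (M N₁ N₂ : LambdaBox.Term P K)
    (hM : LambdaBox.Restricted M) (hτ : LambdaBox.HasType tc Γ M τ)
    (h₁ : Relation.ReflTransGen LambdaBox.Step M N₁)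
    (h₂ : Relation.ReflTransGen LambdaBox.Step M N₂) :
    ∃ L : LambdaBox.Term P K,
      Relation.ReflTransGen LambdaBox.Step N₁ L ∧ Relation.ReflTransGen LambdaBox.Step N₂ L := by
  have hp := hM.proper hτ
  have ht := hτ.nf hp
  obtain ⟨hp₁, hr₁⟩ := LambdaBox.par_nf_of_steps hp h₁
  obtain ⟨hp₂, hr₂⟩ := LambdaBox.par_nf_of_steps hp h₂
  obtain ⟨t, h₁, h₂⟩ := LambdaBox.Anf.confluence ht hr₁ hr₂
  -- Each `Nᵢ` first reduces to the reading of its normal form, which is typed by subject reduction,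
  -- so its parallel reduction to `t` can be read back as steps.
  exact ⟨t.emb,
    hp₁.steps_nf.trans (LambdaBox.steps_of_reflTransGen_par
      (LambdaBox.Anf.reduct_of_reflTransGen ht hr₁) h₁),
    hp₂.steps_nf.trans (LambdaBox.steps_of_reflTransGen_par
      (LambdaBox.Anf.reduct_of_reflTransGen ht hr₂) h₂)⟩
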